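/- Let $X$ be a complex Banach space and let $A$ generate a strongly continuous semigroup $\{e^{tA}\}_{t\ge 0}$ on $X$ with $1\in\rho(e^{2\pi A})$. For $1\le p<\infty$ let $\Gamma_{per}$ denote the generator of the evolution semigroup $(E^t_{per}f)(s)=e^{tA}f([s-t]\,(\mathrm{mod}\,2\pi))$, $t\ge 0$, on $L^p([0,2\pi],X)$. Then $i\mathbb{Z}\subset\rho(A)$, and $\Gamma_{per}$ is invertible for every such $p$. Moreover, let $U,Y$ be complex Banach spaces, $B\in\mathcal{L}(U,X)$, $C\in\mathcal{L}(X,Y)$, let $\mathcal{B}:L^p([0,2\pi],U)\to L^p([0,2\pi],X)$ and $\mathcal{C}:L^p([0,2\pi],X)\to L^p([0,2\pi],Y)$ be the operators of pointwise multiplication by $B$ and $C$, and let \[ rc^1_{stab}(e^{2\pi A},B,C):=\sup\{r>0:\ \|\Delta\|_{\mathcal{L}(Y,U)}\le r\ \Rightarrow\ 1\in\rho(e^{2\pi(A+B\Delta C)})\}\in[0,\infty] \] be the pointwise stability radius, where $\{e^{t(A+B\Delta C)}\}_{t\ge0}$ is the strongly continuous semigroup generated by $A+B\Delta C$. Then,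 for every $1\le p<\infty$, \[ \frac{1}{\|\mathcal{C}\Gamma_{per}^{-1}\mathcal{B}\|_{\mathcal{L}(L^p([0,2\pi],U),L^p([0,2\pi],Y))}}\ \le\ rc^1_{stab}(e^{2\pi A},B,C)\ \le\ \frac{1}{\sup_{k\in\mathbb{Z}}\|C(A-ik)^{-1}B\|_{\mathcal{L}(U,Y)}}, \] with the convention $1/0=\infty$. If $U$ and $Y$ are Hilbert spaces and $p=2$, then both inequalities are equalities. -/

import Mathlib

open MeasureTheory Topology Filter
open scoped ENNReal

universe u v w

noncomputable section

namespace StabRadius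

/-- The interval `[0, 2π]` with arithmetic modulo `2π` is the circle `ℝ / 2πℤ`. -/
instance factTwoPiPos : Fact (0 < 2 * Real.pi) := ⟨Real.two_pi_pos⟩

section Semigroups

variable {X : Type*} [NormedAddCommGroup X] [NormedSpace ℂ X]

/-- `(T t)_{t ≥ 0}` is a strongly continuous semigroup of bounded operators on `X`.
The values of `T` at negative times are irrelevant. -/
structure IsC0Semigroup (T : ℝ → X →L[ℂ] X) : Prop where
  map_zero : T 0 = ContinuousLinearMap.id ℂ X
  map_add : ∀ s t : ℝ, 0 ≤ s → 0 ≤ t → T (s + t) = T s ∘L T t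
  continuousOn : ∀ x : X, ContinuousOn (fun t => T t x) (Set.Ici 0)

/-- `y` is the right derivative at `0` of the orbit of `x`. -/
def HasGenValue (T : ℝ → X →L[ℂ] X) (x y : X) : Prop :=
  Tendsto (fun t : ℝ => ((t : ℂ)⁻¹) • (T t x - x)) (𝓝[>] 0) (𝓝 y)

theorem HasGenValue.zero (T : ℝ → X →L[ℂ] X) : HasGenValue T 0 0 := by
  simp [HasGenValue]

theorem HasGenValue.add {T : ℝ → X →L[ℂ] X} {x y x' y' : X}
    (h : HasGenValue T x y) (h' : HasGenValue T x' y') : HasGenValue T (x + x') (y + y') := by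
  refine (Tendsto.add h h').congr fun t => ?_
  rw [← smul_add, _root_.map_add]
  congr 1
  abel

theorem HasGenValue.smul {T : ℝ → X →L[ℂ] X} {x y : X} (c : ℂ)
    (h : HasGenValue T x y) : HasGenValue T (c • x) (c • y) := by
  refine (Tendsto.const_smul h c).congr fun t => ?_
  rw [_root_.map_smul, ← smul_sub, smul_comm]

theorem HasGenValue.unique {T : ℝ → X →L[ℂ] X} {x y y' : X}
    (h : HasGenValue T x y) (h' : HasGenValue T x y') : y = y' :=
  tendsto_nhds_unique h h'

/-- The (infinitesimal) generator of a one-parameter family of operators: its domain is the set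
of all `x` for which `lim_{t → 0+} (T t x - x) / t` exists, and its value at `x` is this limit. -/
def generator (T : ℝ → X →L[ℂ] X) : X →ₗ.[ℂ] X where
  domain :=
    { carrier := {x | ∃ y, HasGenValue T x y}
      zero_mem' := ⟨0, HasGenValue.zero T⟩
      add_mem' := fun ⟨y, h⟩ ⟨y', h'⟩ => ⟨y + y', h.add h'⟩
      smul_mem' := fun c _ ⟨y, h⟩ => ⟨c • y, h.smul c⟩ }
  toFun :=
    { toFun := fun x => x.2.choose
      map_add' := fun x x' =>
        (x + x').2.choose_spec.unique (x.2.choose_spec.add x'.2.choose_spec)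
      map_smul' := fun c x => (c • x).2.choose_spec.unique (x.2.choose_spec.smul c) }

theorem mem_generator_domain {T : ℝ → X →L[ℂ] X} {x : X} :
    x ∈ (generator T).domain ↔ ∃ y, HasGenValue T x y := Iff.rfl

theorem generator_spec (T : ℝ → X →L[ℂ] X) (x : (generator T).domain) :
    HasGenValue T x (generator T x) := x.2.choose_spec

/-- `R` is the bounded inverse `(A - z)⁻¹` of the (possibly unbounded) operator `A - z`. -/
structure IsResolventAt (A : X →ₗ.[ℂ] X) (z : ℂ) (R : X →L[ℂ] X) : Prop where
  mem_domain : ∀ x : X, R x ∈ A.domain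
  right_inv : ∀ x : X, A ⟨R x, mem_domain x⟩ - z • R x = x
  left_inv : ∀ x : A.domain, R (A x - z • (x : X)) = x

/-- `z ∈ ρ(A)`: the operator `A - z` has an inverse that is bounded and everywhere defined. -/
def InResolventSet (A : X →ₗ.[ℂ] X) (z : ℂ) : Prop :=
  ∃ R : X →L[ℂ] X, IsResolventAt A z R

open Classical in
/-- `(A - z)⁻¹` for `z ∈ ρ(A)` (and `0` by convention for other `z`). -/
def resolventOp (A : X →ₗ.[ℂ] X) (z : ℂ) : X →L[ℂ] X :=
  if h : InResolventSet A z then h.choose else 0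

theorem IsResolventAt.unique {A : X →ₗ.[ℂ] X} {z : ℂ} {R R' : X →L[ℂ] X}
    (h : IsResolventAt A z R) (h' : IsResolventAt A z R') : R = R' := by
  ext x
  have := h.left_inv ⟨R' x, h'.mem_domain x⟩
  rwa [h'.right_inv x] at this

theorem IsResolventAt.resolventOp_eq {A : X →ₗ.[ℂ] X} {z : ℂ} {R : X →L[ℂ] X}
    (h : IsResolventAt A z R) : resolventOp A z = R := by
  have hz : InResolventSet A z := ⟨R, h⟩
  rw [resolventOp, dif_pos hz]
  exact hz.choose_spec.unique h

end Semigroups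

section PointwiseRadius

variable {X U Y : Type*} [NormedAddCommGroup X] [NormedSpace ℂ X]
  [NormedAddCommGroup U] [NormedSpace ℂ U] [NormedAddCommGroup Y] [NormedSpace ℂ Y]

/-- The operator `A + D`, `D` bounded, with the domain of `A`. -/
def addBounded (A : X →ₗ.[ℂ] X) (D : X →L[ℂ] X) : X →ₗ.[ℂ] X :=
  (D : X →ₗ[ℂ] X) +ᵥ A

/-- `z ∈ ρ(e^{tA})`: the operator `A` generates a strongly continuous semigroup (which is then
unique), and `z` is in the resolvent set of its member at time `t`. -/
def InResolventSetExp (A : X →ₗ.[ℂ] X) (t : ℝ) (z : ℂ) : Prop :=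
  ∃ S : ℝ → X →L[ℂ] X, IsC0Semigroup S ∧ generator S = A ∧ z ∈ resolventSet ℂ (S t)

/-- The pointwise stability radius `rc_stab^z(e^{tA}, B, C)`: the supremum, in `[0, ∞]`, of all
`r > 0` such that `z ∈ ρ(e^{t(A + BΔC)})` for every `Δ ∈ L(Y, U)` with `‖Δ‖ ≤ r`. -/
def pointwiseStabRadius (z : ℂ) (t : ℝ) (A : X →ₗ.[ℂ] X) (B : U →L[ℂ] X) (C : X →L[ℂ] Y) :
    ℝ≥0∞ :=
  sSup {ρ : ℝ≥0∞ | ∃ r : ℝ, 0 < r ∧ ρ = ENNReal.ofReal r ∧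
    ∀ Δ : Y →L[ℂ] U, ‖Δ‖ ≤ r → InResolventSetExp (addBounded A (B ∘L Δ ∘L C)) t z}

end PointwiseRadius

section Periodic

variable {X : Type*} [NormedAddCommGroup X] [NormedSpace ℂ X]

/-- `L^p([0, 2π], X)`, as the space of `p`-integrable functions on `ℝ / 2πℤ` with respect to
Lebesgue measure (total mass `2π`). -/
abbrev PerLp (X : Type*) [NormedAddCommGroup X] (p : ℝ≥0∞) : Type _ :=
  Lp X p (volume : Measure (AddCircle (2 * Real.pi)))

/-- The periodic evolution semigroup on `L^p([0, 2π], X)`: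
`(E^t f)(s) = T(t) f([s - t] mod 2π)`. -/
def perEvolution (T : ℝ → X →L[ℂ] X) (p : ℝ≥0∞) [Fact (1 ≤ p)] (t : ℝ) :
    PerLp X p →L[ℂ] PerLp X p :=
  (T t).compLpL p volume ∘L
    (Lp.compMeasurePreservingₗᵢ ℂ (fun s : AddCircle (2 * Real.pi) => s - (t : AddCircle _))
      (measurePreserving_sub_right volume (t : AddCircle (2 * Real.pi)))).toContinuousLinearMap

theorem perEvolution_apply_ae (T : ℝ → X →L[ℂ] X) (p : ℝ≥0∞) [Fact (1 ≤ p)] (t : ℝ)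
    (f : PerLp X p) :
    perEvolution T p t f =ᵐ[volume]
      fun s : AddCircle (2 * Real.pi) => T t (f (s - (t : AddCircle (2 * Real.pi)))) := by
  have h1 := (T t).coeFn_compLpL (p := p)
    (Lp.compMeasurePreserving (fun s : AddCircle (2 * Real.pi) => s - (t : AddCircle _))
      (measurePreserving_sub_right volume (t : AddCircle (2 * Real.pi))) f)
  have h2 := Lp.coeFn_compMeasurePreserving f
    (measurePreserving_sub_right volume (t : AddCircle (2 * Real.pi)))
  filter_upwards [h1, h2] with s hs1 hs2
  exact hs1.trans (congrArg (T t) hs2)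

/-- The generator `Γ_per` of the periodic evolution semigroup on `L^p([0, 2π], X)`. -/
def perGenerator (T : ℝ → X →L[ℂ] X) (p : ℝ≥0∞) [Fact (1 ≤ p)] :
    PerLp X p →ₗ.[ℂ] PerLp X p :=
  generator (perEvolution T p)

variable {U Y : Type*} [NormedAddCommGroup U] [NormedSpace ℂ U]
  [NormedAddCommGroup Y] [NormedSpace ℂ Y]

/-- The operator `𝓒 Γ_per⁻¹ 𝓑 : L^p([0, 2π], U) → L^p([0, 2π], Y)`, where `𝓑` and `𝓒` are the
operators of pointwise multiplication by `B` and `C`. -/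
def perInputOutput (T : ℝ → X →L[ℂ] X) (p : ℝ≥0∞) [Fact (1 ≤ p)]
    (B : U →L[ℂ] X) (C : X →L[ℂ] Y) : PerLp U p →L[ℂ] PerLp Y p :=
  C.compLpL p volume ∘L resolventOp (perGenerator T p) 0 ∘L B.compLpL p volume

/-- The transfer function `C (A - z)⁻¹ B`. -/
def transferFn (A : X →ₗ.[ℂ] X) (B : U →L[ℂ] X) (C : X →L[ℂ] Y) (z : ℂ) : U →L[ℂ] Y :=
  C ∘L resolventOp A z ∘L B

end Periodic

end StabRadius

end

noncomputable section

namespace StabRadius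

/-! ### Semigroups, rescaling and spectral inclusion -/

section Basics

variable {X : Type*} [NormedAddCommGroup X] [NormedSpace ℂ X]

/-! Everything rests on solving for periodic orbits. For a semigroup `T` with generator `A`, the
operator `J = ∫₀^τ T(s) ds` satisfies `A J = T(τ) - 1`, and `J A = T(τ) - 1` on the domain. So an
inverse `Q` of `T(τ) - 1` gives `A⁻¹ = J Q` (`IsC0Semigroup.isResolventAt_zero`). Applied to
`e^{-ikt} T(t)`, which has the same value as `T` at `2π`, this puts `ik` in `ρ(A)`. Applied to the
periodic evolution semigroup, which at time `2π` is pointwise multiplication by `T(2π)`, it inverts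
`Γ_per`.

Lower bound: let `D = BΔC`, `R = (1 - T(2π))⁻¹`, and let `S` be the semigroup of `A + D`. By density
and a Green function computation, `-Γ_per⁻¹ f` is the periodic mild solution of `u' = Au + f`
(`resolventOp_perGenerator_ae`). If `‖Δ‖ ‖𝓒 Γ_per⁻¹ 𝓑‖ < 1`, the equation `f + Γ_per⁻¹ 𝓑Δ𝓒 f = z` is
uniquely solvable. With `z = 0` this forbids nonzero fixed points of `S(2π)`; with `z(t) = T(t) R y`
the solution is an orbit of `S` whose initial value solves `(1 - S(2π)) x = y`. This is
`one_mem_resolventSet_of_isPerturbation`.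

Upper bound: if `‖C (A - ik)⁻¹ B v‖ > ‖v‖ / r`, a rank-one `Δ` of norm at most `r` makes `ik` an
eigenvalue of `A + BΔC`, contradicting spectral inclusion (`norm_transferFn_le`).

Hilbert case: `𝓒 Γ_per⁻¹ 𝓑` acts on the mode `e^{iks} v` through the transfer function at `ik`. By
Parseval its norm is at most the supremum of the transfer functions, so the two outer bounds
coincide. -/

/-- The forward extension of an operator family: constant `T 0` at negative times. -/
def fwd (T : ℝ → X →L[ℂ] X) (t : ℝ) : X →L[ℂ] X := T (max t 0)

theorem fwd_of_nonneg (T : ℝ → X →L[ℂ] X) {t : ℝ} (ht : 0 ≤ t) : fwd T t = T t := by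
  simp [fwd, ht]

variable {T : ℝ → X →L[ℂ] X}

theorem IsC0Semigroup.map_add_apply (hT : IsC0Semigroup T) {s t : ℝ} (hs : 0 ≤ s) (ht : 0 ≤ t)
    (x : X) : T (s + t) x = T s (T t x) := by
  rw [hT.map_add s t hs ht]; rfl

theorem IsC0Semigroup.comm_apply (hT : IsC0Semigroup T) {s t : ℝ} (hs : 0 ≤ s) (ht : 0 ≤ t)
    (x : X) : T s (T t x) = T t (T s x) := by
  rw [← hT.map_add_apply hs ht, add_comm, hT.map_add_apply ht hs]

theorem IsC0Semigroup.continuous_fwd_apply (hT : IsC0Semigroup T) (x : X) :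
    Continuous fun t => fwd T t x :=
  (hT.continuousOn x).comp_continuous (f := fun t : ℝ => max t 0) (by fun_prop)
    fun t => le_max_right t 0

theorem IsC0Semigroup.exists_bound_Icc [CompleteSpace X] (hT : IsC0Semigroup T) (τ : ℝ) :
    ∃ M : ℝ, 1 ≤ M ∧ ∀ t ∈ Set.Icc 0 τ, ‖T t‖ ≤ M := by
  have h : ∀ x, ∃ C, ∀ i : Set.Icc (0 : ℝ) τ, ‖T i x‖ ≤ C := by
    intro x
    obtain ⟨C, hC⟩ := isCompact_Icc.exists_bound_of_continuousOn
      ((hT.continuousOn x).mono (fun t (ht : t ∈ Set.Icc 0 τ) => ht.1))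
    exact ⟨C, fun i => hC i i.2⟩
  obtain ⟨C, hC⟩ := banach_steinhaus h
  exact ⟨max C 1, le_max_right _ _, fun t ht => (hC ⟨t, ht⟩).trans (le_max_left _ _)⟩

/-- Each unit of time costs one factor `M`, the bound on `[0, 1]`; hence the rate `log M`. -/
theorem IsC0Semigroup.exists_exp_bound [CompleteSpace X] (hT : IsC0Semigroup T) :
    ∃ M ω : ℝ, 1 ≤ M ∧ 0 ≤ ω ∧ ∀ t, 0 ≤ t → ‖T t‖ ≤ M * Real.exp (ω * t) := by
  obtain ⟨M, hM1, hM⟩ := hT.exists_bound_Icc 1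
  have hM0 : 0 < M := by linarith
  have hω : 0 ≤ Real.log M := Real.log_nonneg hM1
  refine ⟨M, Real.log M, hM1, hω, ?_⟩
  have key : ∀ n : ℕ, ∀ t : ℝ, 0 ≤ t → t ≤ n + 1 → ‖T t‖ ≤ M * Real.exp (Real.log M * t) := by
    intro n
    induction n with
    | zero =>
      intro t h0 h1
      refine (hM t ⟨h0, by simpa using h1⟩).trans (le_mul_of_one_le_right hM0.le ?_)
      exact Real.one_le_exp (by positivity)
    | succ n ih =>
      intro t h0 h1
      by_cases h : t ≤ 1
      · refine (hM t ⟨h0, h⟩).trans (le_mul_of_one_le_right hM0.le ?_)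
        exact Real.one_le_exp (by positivity)
      · push Not at h
        have e : T t = T 1 ∘L T (t - 1) := by
          rw [← hT.map_add 1 (t - 1) (by norm_num) (by linarith)]; congr 1; ring
        have i1 := ih (t - 1) (by linarith) (by push_cast at h1; linarith)
        calc ‖T t‖ ≤ ‖T 1‖ * ‖T (t - 1)‖ := by rw [e]; exact ContinuousLinearMap.opNorm_comp_le _ _
          _ ≤ M * (M * Real.exp (Real.log M * (t - 1))) := by
            gcongr
            exact hM 1 ⟨by norm_num, le_rfl⟩
          _ = M * Real.exp (Real.log M * t) := by
            rw [mul_sub, mul_one, Real.exp_sub, Real.exp_log hM0]; field_simp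
  intro t ht
  obtain ⟨n, hn⟩ := exists_nat_ge t
  exact key n t ht (by linarith)

theorem IsC0Semigroup.exists_bound_fwd [CompleteSpace X] (hT : IsC0Semigroup T) (τ : ℝ) :
    ∃ M : ℝ, 1 ≤ M ∧ ∀ t ≤ τ, ‖fwd T t‖ ≤ M := by
  obtain ⟨M, h1, hM⟩ := hT.exists_bound_Icc (max τ 0)
  exact ⟨M, h1, fun t ht => hM _ ⟨le_max_right _ _, max_le_max_right 0 ht⟩⟩

/-- A locally bounded family of operators that is strongly continuous on a dense set is
jointly continuous. -/
theorem continuous_uncurry_of_dense {E F : Type*} [NormedAddCommGroup E] [NormedSpace ℂ E]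
    [NormedAddCommGroup F] [NormedSpace ℂ F] {G : ℝ → E →L[ℂ] F} {s : Set E} (hs : Dense s)
    (hb : ∀ τ : ℝ, ∃ M : ℝ, ∀ t ≤ τ, ‖G t‖ ≤ M) (hG : ∀ x ∈ s, Continuous fun t => G t x) :
    Continuous fun z : ℝ × E => G z.1 z.2 := by
  have key : ∀ τ : ℝ, Continuous fun z : E × Set.Iic τ => G z.2 z.1 := by
    intro τ
    obtain ⟨M, hM⟩ := hb τ
    refine continuous_prod_of_dense_continuous_lipschitzWith (f := fun z : E × Set.Iic τ => G z.2 z.1)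
      (K := M.toNNReal) hs
      (fun x hx => (hG x hx).comp continuous_subtype_val) fun t => ?_
    refine (G t).lipschitz.weaken ?_
    rw [← NNReal.coe_le_coe]
    exact (hM t t.2).trans (Real.le_coe_toNNReal M)
  rw [continuous_iff_continuousAt]
  rintro ⟨t, x⟩
  have h1 : ContinuousOn (fun z : ℝ × E => G z.1 z.2) (Set.Iic (t + 1) ×ˢ Set.univ) := by
    rw [continuousOn_iff_continuous_domRestrict]
    exact (key (t + 1)).comp (f := fun z : ↥(Set.Iic (t + 1) ×ˢ (Set.univ : Set E)) =>
      ((z : ℝ × E).2, (⟨(z : ℝ × E).1, z.2.1⟩ : Set.Iic (t + 1)))) (by fun_prop)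
  exact h1.continuousAt (prod_mem_nhds (Iic_mem_nhds (by simp)) univ_mem)

theorem IsC0Semigroup.continuous_fwd [CompleteSpace X] (hT : IsC0Semigroup T) :
    Continuous fun z : ℝ × X => fwd T z.1 z.2 :=
  continuous_uncurry_of_dense dense_univ
    (fun τ => (hT.exists_bound_fwd τ).imp fun _ h => h.2) fun x _ => hT.continuous_fwd_apply x

/-- The rescaled family `e^{ct} T(t)`. -/
def expRescale (c : ℂ) (T : ℝ → X →L[ℂ] X) (t : ℝ) : X →L[ℂ] X := Complex.exp (c * t) • T t

theorem IsC0Semigroup.rescale (hT : IsC0Semigroup T) (c : ℂ) : IsC0Semigroup (expRescale c T) where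
  map_zero := by simp [expRescale, hT.map_zero]
  map_add s t hs ht := by
    ext x
    simp only [expRescale, hT.map_add s t hs ht, ContinuousLinearMap.comp_apply,
      smul_apply, map_smul, smul_smul]
    rw [← Complex.exp_add]
    push_cast
    ring_nf
  continuousOn x := by
    have h : Continuous fun t : ℝ => Complex.exp (c * t) := by fun_prop
    exact h.continuousOn.smul (hT.continuousOn x)

theorem HasGenValue.rescale {x y : X} (c : ℂ)
    (h : HasGenValue T x y) : HasGenValue (expRescale c T) x (y + c • x) := by
  have hexp : Tendsto (fun t : ℝ => Complex.exp (c * t)) (𝓝[>] 0) (𝓝 1) := by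
    have : Continuous fun t : ℝ => Complex.exp (c * t) := by fun_prop
    simpa using (this.tendsto 0).mono_left nhdsWithin_le_nhds
  have hder : Tendsto (fun t : ℝ => (t : ℂ)⁻¹ * (Complex.exp (c * t) - 1)) (𝓝[>] 0) (𝓝 c) := by
    have h1 : HasDerivAt (fun t : ℝ => Complex.exp (c * t)) c 0 := by
      have h2 : HasDerivAt (fun t : ℝ => c * (t : ℂ)) c 0 := by
        simpa using (Complex.ofRealCLM.hasDerivAt (x := (0 : ℝ))).const_mul c
      simpa using h2.cexp
    have h3 := h1.tendsto_slope_zero_right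
    simpa using h3
  have := (hexp.smul h).add (hder.smul_const x)
  rw [one_smul] at this
  refine this.congr fun t => ?_
  simp only [expRescale, smul_apply, smul_sub, smul_smul, mul_sub,
    sub_smul, mul_one]
  rw [mul_comm (Complex.exp _)]
  abel

theorem rescale_rescale (c d : ℂ) (T : ℝ → X →L[ℂ] X) :
    expRescale c (expRescale d T) = expRescale (c + d) T := by
  funext t
  simp only [expRescale, smul_smul, ← Complex.exp_add, add_mul]

@[simp] theorem rescale_zero (T : ℝ → X →L[ℂ] X) : expRescale 0 T = T := by
  funext t; simp [expRescale]

theorem hasGenValue_rescale_iff (c : ℂ) {x y : X} :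
    HasGenValue (expRescale c T) x (y + c • x) ↔ HasGenValue T x y := by
  refine ⟨fun h => ?_, fun h => h.rescale c⟩
  have := h.rescale (-c)
  rw [rescale_rescale] at this
  simpa using this

theorem generator_eq_of_hasGenValue {x : (generator T).domain} {y : X}
    (h : HasGenValue T x y) : generator T x = y :=
  (generator_spec T x).unique h

/-- Trades elements of the domain subtype for the relation `HasGenValue`, which is stable under
rescaling, bounded perturbation and passage to Fourier modes. -/
theorem isResolventAt_generator_iff {R : X →L[ℂ] X} {z : ℂ} :
    IsResolventAt (generator T) z R ↔
      (∀ x, HasGenValue T (R x) (x + z • R x)) ∧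
        ∀ x y, HasGenValue T x y → R (y - z • x) = x := by
  constructor
  · intro h
    refine ⟨fun x => ?_, fun x y hxy => ?_⟩
    · have := generator_spec T ⟨R x, h.mem_domain x⟩
      rwa [sub_eq_iff_eq_add.mp (h.right_inv x)] at this
    · have := h.left_inv ⟨x, y, hxy⟩
      have e : generator T ⟨x, y, hxy⟩ = y := generator_eq_of_hasGenValue hxy
      exact e ▸ this
  · rintro ⟨h1, h2⟩
    refine ⟨fun x => ⟨_, h1 x⟩, fun x => ?_, fun x => h2 _ _ (generator_spec T x)⟩
    have e : generator T ⟨R x, _, h1 x⟩ = x + z • R x := generator_eq_of_hasGenValue (h1 x)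
    exact (congrArg (· - z • R x) e).trans (add_sub_cancel_right _ _)

theorem IsResolventAt.of_rescale {R : X →L[ℂ] X} {c z : ℂ}
    (h : IsResolventAt (generator (expRescale c T)) (z + c) R) :
    IsResolventAt (generator T) z R := by
  rw [isResolventAt_generator_iff] at h ⊢
  refine ⟨fun x => ?_, fun x y hxy => ?_⟩
  · rw [← hasGenValue_rescale_iff c]
    simpa [add_smul, add_assoc] using h.1 x
  · have := h.2 _ _ ((hasGenValue_rescale_iff c).2 hxy)
    rwa [add_smul, add_sub_add_right_eq_sub] at this

/-- The integrated semigroup `x ↦ ∫₀^τ T(s) x ds`. -/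
def integrated [CompleteSpace X] (hT : IsC0Semigroup T) (τ : ℝ) : X →L[ℂ] X :=
  LinearMap.mkContinuousOfExistsBound
    { toFun := fun x => ∫ s in (0 : ℝ)..τ, fwd T s x
      map_add' := fun x y => by
        simp only [map_add]
        exact intervalIntegral.integral_add ((hT.continuous_fwd_apply x).intervalIntegrable _ _)
          ((hT.continuous_fwd_apply y).intervalIntegrable _ _)
      map_smul' := fun c x => by
        simp only [map_smul]
        exact intervalIntegral.integral_smul _ _ }
    (by
      obtain ⟨M, -, hM⟩ := hT.exists_bound_fwd (max 0 τ)
      refine ⟨M * |τ - 0|, fun x => ?_⟩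
      have := intervalIntegral.norm_integral_le_of_norm_le_const (a := 0) (b := τ)
        (f := fun s => fwd T s x) (C := M * ‖x‖) fun s hs =>
          (fwd T s).le_of_opNorm_le (hM s (Set.uIoc_subset_uIcc hs).2) x
      calc _ ≤ M * ‖x‖ * |τ - 0| := this
        _ = _ := by ring)

theorem integrated_apply [CompleteSpace X] (hT : IsC0Semigroup T) (τ : ℝ) (x : X) :
    integrated hT τ x = ∫ s in (0 : ℝ)..τ, fwd T s x := rfl

theorem tendsto_average_right {f : ℝ → X} (hf : Continuous f) (a : ℝ) [CompleteSpace X] :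
    Tendsto (fun h : ℝ => (h : ℂ)⁻¹ • ∫ s in a..a + h, f s) (𝓝[>] 0) (𝓝 (f a)) := by
  have h1 : HasDerivAt (fun b => ∫ s in a..b, f s) (f a) a :=
    intervalIntegral.integral_hasDerivAt_right (hf.intervalIntegrable _ _)
      hf.stronglyMeasurable.stronglyMeasurableAtFilter hf.continuousAt
  have := h1.tendsto_slope_zero_right
  simp only [intervalIntegral.integral_same, sub_zero] at this
  refine this.congr fun t => ?_
  rw [← Complex.ofReal_inv, Complex.coe_smul]

/-- Applying `T h` slides the window of integration from `[0, τ]` to `[h, τ + h]`, so only the two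
ends survive; dividing by `h` turns them into averages. -/
theorem IsC0Semigroup.map_integrated_sub [CompleteSpace X] (hT : IsC0Semigroup T) {h τ : ℝ}
    (hh : 0 ≤ h) (hτ : 0 ≤ τ) (x : X) :
    T h (integrated hT τ x) - integrated hT τ x =
      (∫ s in τ..τ + h, fwd T s x) - ∫ s in (0 : ℝ)..0 + h, fwd T s x := by
  have hi := fun a b => (hT.continuous_fwd_apply x).intervalIntegrable (μ := volume) a b
  have e1 : T h (integrated hT τ x) = ∫ s in h..τ + h, fwd T s x := by
    rw [integrated_apply, ← ContinuousLinearMap.intervalIntegral_comp_comm _ (hi _ _)]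
    rw [show (∫ s in h..τ + h, fwd T s x) = ∫ s in 0 + h..τ + h, fwd T s x by simp,
      ← intervalIntegral.integral_comp_add_right]
    refine intervalIntegral.integral_congr fun s hs => ?_
    rw [Set.uIcc_of_le hτ] at hs
    rw [fwd_of_nonneg T hs.1, fwd_of_nonneg T (by linarith [hs.1]), add_comm,
      hT.map_add_apply hh hs.1]
  rw [e1, integrated_apply, zero_add]
  have a1 := intervalIntegral.integral_add_adjacent_intervals (hi 0 h) (hi h (τ + h))
  have a2 := intervalIntegral.integral_add_adjacent_intervals (hi 0 τ) (hi τ (τ + h))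
  rw [sub_eq_sub_iff_add_eq_add, add_comm, a1, ← a2, add_comm]

theorem IsC0Semigroup.hasGenValue_integrated [CompleteSpace X] (hT : IsC0Semigroup T) {τ : ℝ}
    (hτ : 0 ≤ τ) (x : X) : HasGenValue T (integrated hT τ x) (T τ x - x) := by
  have h1 := (tendsto_average_right (hT.continuous_fwd_apply x) τ).sub
    (tendsto_average_right (hT.continuous_fwd_apply x) 0)
  rw [fwd_of_nonneg T hτ, fwd_of_nonneg T le_rfl, hT.map_zero] at h1
  refine h1.congr' ?_
  filter_upwards [self_mem_nhdsWithin] with h hh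
  rw [← smul_sub, hT.map_integrated_sub (le_of_lt hh) hτ]

theorem IsC0Semigroup.integrated_comm [CompleteSpace X] (hT : IsC0Semigroup T) {h τ : ℝ}
    (hh : 0 ≤ h) (hτ : 0 ≤ τ) (x : X) : integrated hT τ (T h x) = T h (integrated hT τ x) := by
  rw [integrated_apply, integrated_apply, ← ContinuousLinearMap.intervalIntegral_comp_comm _
    ((hT.continuous_fwd_apply x).intervalIntegrable _ _)]
  refine intervalIntegral.integral_congr fun s hs => ?_
  rw [Set.uIcc_of_le hτ] at hs
  rw [fwd_of_nonneg T hs.1, hT.comm_apply hs.1 hh]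

/-- The bounded integrated operator commutes with the difference quotients, so both orders of
composition have the same limit; closedness of the generator is not needed. -/
theorem IsC0Semigroup.integrated_of_hasGenValue [CompleteSpace X] (hT : IsC0Semigroup T) {τ : ℝ}
    (hτ : 0 ≤ τ) {x y : X} (h : HasGenValue T x y) : integrated hT τ y = T τ x - x := by
  refine tendsto_nhds_unique (((integrated hT τ).continuous.tendsto y).comp h) ?_
  refine (hT.hasGenValue_integrated hτ x).congr' ?_
  filter_upwards [self_mem_nhdsWithin] with s hs
  simp [hT.integrated_comm (le_of_lt hs) hτ]

/-- Spectral inclusion: if `T(τ) - 1` is invertible, so is the generator. -/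
theorem IsC0Semigroup.isResolventAt_zero [CompleteSpace X] (hT : IsC0Semigroup T) {τ : ℝ}
    (hτ : 0 ≤ τ) {Q : X →L[ℂ] X} (h1 : ∀ x, T τ (Q x) - Q x = x) (h2 : ∀ x, Q (T τ x - x) = x) :
    IsResolventAt (generator T) 0 (integrated hT τ ∘L Q) := by
  rw [isResolventAt_generator_iff]
  refine ⟨fun x => ?_, fun x y h => ?_⟩
  · have := hT.hasGenValue_integrated hτ (Q x)
    rw [h1] at this
    simpa using this
  · have e := hT.integrated_of_hasGenValue hτ h
    -- The integrated operator commutes with `T τ - 1`, hence with its inverse `Q`.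
    have hc : ∀ z, Q (integrated hT τ z) = integrated hT τ (Q z) := by
      intro z
      have := h2 (integrated hT τ (Q z))
      rw [← hT.integrated_comm hτ hτ, ← map_sub, h1] at this
      exact this
    simp only [zero_smul, sub_zero, ContinuousLinearMap.comp_apply]
    rw [← hc, e, h2]

theorem exists_inverse_of_mem_resolventSet {S : X →L[ℂ] X} (h : (1 : ℂ) ∈ resolventSet ℂ S) :
    ∃ R : X →L[ℂ] X, (∀ x, R x - S (R x) = x) ∧ ∀ x, R (x - S x) = x := by
  obtain ⟨U, hU⟩ : IsUnit (algebraMap ℂ (X →L[ℂ] X) 1 - S) := h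
  rw [map_one] at hU
  refine ⟨↑U⁻¹, fun x => ?_, fun x => ?_⟩
  · have := congrArg (fun L : X →L[ℂ] X => L x) U.mul_inv
    rw [hU] at this
    simpa using this
  · have := congrArg (fun L : X →L[ℂ] X => L x) U.inv_mul
    rw [hU] at this
    simpa using this

theorem IsC0Semigroup.inResolventSet_zero [CompleteSpace X] (hT : IsC0Semigroup T) {τ : ℝ}
    (hτ : 0 ≤ τ) (h : (1 : ℂ) ∈ resolventSet ℂ (T τ)) : InResolventSet (generator T) 0 := by
  obtain ⟨R, h1, h2⟩ := exists_inverse_of_mem_resolventSet h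
  refine ⟨_, hT.isResolventAt_zero hτ (Q := -R) (fun x => ?_) (fun x => ?_)⟩
  · simpa [sub_eq_add_neg, add_comm] using h1 x
  · rw [neg_apply, ← map_neg, neg_sub, h2]

theorem IsC0Semigroup.inResolventSet_I_mul_int [CompleteSpace X] (hT : IsC0Semigroup T)
    (h : (1 : ℂ) ∈ resolventSet ℂ (T (2 * Real.pi))) (k : ℤ) :
    InResolventSet (generator T) (Complex.I * k) := by
  -- The rescaling factor at time `2π` is `e^{-2πik} = 1`, so one hypothesis serves every `k`.
  have he : expRescale (-(Complex.I * (k : ℂ))) T (2 * Real.pi) = T (2 * Real.pi) := by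
    have : Complex.exp (-(Complex.I * k) * ((2 * Real.pi : ℝ) : ℂ)) = 1 := by
      rw [Complex.exp_eq_one_iff]
      exact ⟨-k, by push_cast; ring⟩
    rw [expRescale, this, one_smul]
  obtain ⟨R, hR⟩ := (hT.rescale (-(Complex.I * (k : ℂ)))).inResolventSet_zero Real.two_pi_pos.le
    (by rwa [he])
  exact ⟨R, IsResolventAt.of_rescale (c := -(Complex.I * (k : ℂ))) (by simpa using hR)⟩

end Basics

/-! ### Bounded perturbations and the variation of constants formula -/

section Perturbation

open scoped BoundedContinuousFunction

variable {X : Type*} [NormedAddCommGroup X] [NormedSpace ℂ X] {T : ℝ → X →L[ℂ] X}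

theorem norm_integral_fwd_sub_le {M t : ℝ}
    (ht : 0 ≤ t) (hM : ∀ s ≤ t, ‖fwd T s‖ ≤ M) {h : ℝ → X}
    (hh : IntervalIntegrable h volume 0 t) :
    ‖∫ r in (0 : ℝ)..t, fwd T (t - r) (h r)‖ ≤ M * ∫ r in (0 : ℝ)..t, ‖h r‖ := by
  rw [← intervalIntegral.integral_const_mul]
  refine intervalIntegral.norm_integral_le_of_norm_le ht ?_ (hh.norm.const_mul M)
  refine Eventually.of_forall fun r hr => ?_
  exact (fwd T (t - r)).le_of_opNorm_le (hM _ (by linarith [hr.1])) _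

/-- A Gronwall argument for merely integrable `w`. The first primitive `φ` of `‖w‖` is only known to
be continuous, so the differential inequality is applied to its own primitive `Φ`, for which `Φ' = φ
≤ c Φ` and `Φ(0) = 0`. -/
theorem eq_zero_of_norm_le_integral {E : Type*} [NormedAddCommGroup E] {w : ℝ → E} {c τ : ℝ} (hc : 0 ≤ c)
    (hw : IntervalIntegrable w volume 0 τ)
    (hle : ∀ t ∈ Set.Icc 0 τ, ‖w t‖ ≤ c * ∫ r in (0 : ℝ)..t, ‖w r‖) :
    ∀ t ∈ Set.Icc 0 τ, w t = 0 := by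
  intro t ht
  have hτ : 0 ≤ τ := ht.1.trans ht.2
  set φ : ℝ → ℝ := fun t => ∫ r in (0 : ℝ)..t, ‖w r‖ with hφ
  have hφc : ContinuousOn φ (Set.Icc 0 τ) := by
    have := intervalIntegral.continuousOn_primitive_interval' hw.norm Set.left_mem_uIcc
    rwa [Set.uIcc_of_le hτ] at this
  have hφi : IntervalIntegrable φ volume 0 τ :=
    ContinuousOn.intervalIntegrable (by rwa [Set.uIcc_of_le hτ])
  have hsub : ∀ t ∈ Set.Icc 0 τ, Set.uIcc 0 t ⊆ Set.uIcc 0 τ := fun t ht =>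
    Set.uIcc_subset_uIcc Set.left_mem_uIcc (by rwa [Set.uIcc_of_le hτ])
  have h1 : ∀ t ∈ Set.Icc 0 τ, φ t ≤ c * ∫ r in (0 : ℝ)..t, φ r := by
    intro t ht
    rw [← intervalIntegral.integral_const_mul]
    refine intervalIntegral.integral_mono_on ht.1 ((hw.mono_set (hsub t ht)).norm)
      ((hφi.mono_set (hsub t ht)).const_mul c) fun r hr => hle r ⟨hr.1, hr.2.trans ht.2⟩
  have hφ0 : ∀ t ∈ Set.Icc 0 τ, 0 ≤ φ t := fun t ht =>
    intervalIntegral.integral_nonneg ht.1 fun _ _ => norm_nonneg _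
  have hΦ0 : ∀ t ∈ Set.Icc 0 τ, ∫ r in (0 : ℝ)..t, φ r = 0 := by
    refine eq_zero_of_abs_deriv_le_mul_abs_self_of_eq_zero_right (f' := φ) (K := c) ?_ ?_ ?_ ?_
    · have := intervalIntegral.continuousOn_primitive_interval' hφi Set.left_mem_uIcc
      rwa [Set.uIcc_of_le hτ] at this
    · intro t ht
      have htc : ContinuousWithinAt φ (Set.Ioi t) t :=
        ((hφc t ⟨ht.1, ht.2.le⟩).mono_of_mem_nhdsWithin
          (mem_of_superset (Ioc_mem_nhdsGT ht.2) fun r hr => ⟨ht.1.trans hr.1.le, hr.2⟩))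
      have htc' : ContinuousWithinAt φ (Set.Ici t) t :=
        ((hφc t ⟨ht.1, ht.2.le⟩).mono_of_mem_nhdsWithin
          (mem_of_superset (Icc_mem_nhdsGE ht.2) fun r hr => ⟨ht.1.trans hr.1, hr.2⟩))
      refine intervalIntegral.integral_hasDerivWithinAt_right
        (hφi.mono_set (hsub t ⟨ht.1, ht.2.le⟩)) (t := Set.Ioi t) ?_ htc
      refine ⟨Set.Ioc t τ, Ioc_mem_nhdsGT ht.2, ?_⟩
      exact (hφc.mono fun r hr => ⟨ht.1.trans hr.1.le, hr.2⟩).aestronglyMeasurable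
        measurableSet_Ioc
    · exact intervalIntegral.integral_same
    · intro t ht
      have ht' : t ∈ Set.Icc 0 τ := ⟨ht.1, ht.2.le⟩
      rw [Real.norm_of_nonneg (hφ0 t ht')]
      exact (h1 t ht').trans (mul_le_mul_of_nonneg_left (le_abs_self _) hc)
  have h2 := h1 t ht
  rw [hΦ0 t ht, mul_zero] at h2
  have h3 := hle t ht
  rw [show (∫ r in (0 : ℝ)..t, ‖w r‖) = 0 from le_antisymm h2 (hφ0 t ht), mul_zero] at h3
  exact norm_le_zero_iff.mp h3

/-- `S` satisfies the variation of constants formula for the perturbation of `T` by `D`. -/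
def IsPerturbation (T : ℝ → X →L[ℂ] X) (D : X →L[ℂ] X) (S : ℝ → X →L[ℂ] X) : Prop :=
  ∀ x t, 0 ≤ t → S t x = T t x + ∫ r in (0 : ℝ)..t, fwd T (t - r) (D (fwd S r x))

theorem norm_fwd_le_of_decay {M μ : ℝ} (hμ : 0 < μ)
    (hM : ∀ t, 0 ≤ t → ‖T t‖ ≤ M * Real.exp (-μ * t)) (t : ℝ) : ‖fwd T t‖ ≤ M := by
  have hM0 : 0 ≤ M := by simpa using (norm_nonneg _).trans (hM 0 le_rfl)
  refine (hM _ (le_max_right t 0)).trans (mul_le_of_le_one_right hM0 ?_)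
  rw [Real.exp_le_one_iff]
  nlinarith [le_max_right t 0]

theorem IsPerturbation.rescale {D : X →L[ℂ] X} {S : ℝ → X →L[ℂ] X} (h : IsPerturbation T D S)
    (c : ℂ) : IsPerturbation (expRescale c T) D (expRescale c S) := by
  intro x t ht
  rw [expRescale, smul_apply, h x t ht, smul_add, ← intervalIntegral.integral_smul]
  congr 1
  refine intervalIntegral.integral_congr fun r hr => ?_
  rw [Set.uIcc_of_le ht] at hr
  change Complex.exp (c * t) • fwd T (t - r) (D (fwd S r x)) =
    fwd (expRescale c T) (t - r) (D (fwd (expRescale c S) r x))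
  have h0 : 0 ≤ t - r := by linarith [hr.2]
  rw [fwd_of_nonneg _ h0, fwd_of_nonneg _ h0, fwd_of_nonneg _ hr.1, fwd_of_nonneg _ hr.1]
  simp only [expRescale, smul_apply, map_smul, smul_smul, ← Complex.exp_add]
  congr 2
  push_cast; ring

/-- The decay makes the kernel integrable, with mass at most `M / μ` uniformly in `t`; this bounds
the Volterra operator on the whole half-line. -/
theorem norm_duhamel_le {M μ : ℝ} (hμ : 0 < μ)
    (hM : ∀ t, 0 ≤ t → ‖T t‖ ≤ M * Real.exp (-μ * t)) (D : X →L[ℂ] X) {u : ℝ → X} {C : ℝ}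
    (hC : ∀ t, ‖u t‖ ≤ C) {t : ℝ} (ht : 0 ≤ t) :
    ‖∫ r in (0 : ℝ)..t, fwd T (t - r) (D (u r))‖ ≤ M * ‖D‖ / μ * C := by
  have hC0 : 0 ≤ C := (norm_nonneg _).trans (hC 0)
  have hM0 : 0 ≤ M := by simpa using (norm_nonneg _).trans (hM 0 le_rfl)
  have hd : ∀ r : ℝ, HasDerivAt (fun r => M * ‖D‖ / μ * C * Real.exp (-μ * (t - r)))
      (M * Real.exp (-μ * (t - r)) * (‖D‖ * C)) r := by
    intro r
    have h1 : HasDerivAt (fun r => -μ * (t - r)) μ r := by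
      simpa using ((hasDerivAt_id r).const_sub t).const_mul (-μ)
    have h2 := h1.exp.const_mul (M * ‖D‖ / μ * C)
    exact h2.congr_deriv (by field_simp)
  have hi : IntervalIntegrable (fun r => M * Real.exp (-μ * (t - r)) * (‖D‖ * C)) volume 0 t :=
    Continuous.intervalIntegrable (by fun_prop) _ _
  refine (intervalIntegral.norm_integral_le_of_norm_le ht
    (Eventually.of_forall fun r hr => ?_) hi).trans ?_
  · rw [fwd_of_nonneg T (by linarith [hr.2])]
    refine ((T (t - r)).le_opNorm _).trans ?_
    have := hM (t - r) (by linarith [hr.2])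
    gcongr
    exact D.le_opNorm_of_le (hC r)
  · rw [intervalIntegral.integral_eq_sub_of_hasDerivAt (fun r _ => hd r) hi]
    simp only [sub_self, mul_zero, Real.exp_zero, mul_one]
    exact sub_le_self _ (by positivity)

/-- The map taking a vector to its forward orbit. -/
def orbit (hT : IsC0Semigroup T) {M μ : ℝ} (hμ : 0 < μ)
    (hM : ∀ t, 0 ≤ t → ‖T t‖ ≤ M * Real.exp (-μ * t)) : X →L[ℂ] (ℝ →ᵇ X) :=
  LinearMap.mkContinuous
    { toFun := fun x => BoundedContinuousFunction.ofNormedAddCommGroup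
        (fun t => fwd T t x) (hT.continuous_fwd_apply x) (M * ‖x‖)
        (fun t => (fwd T t).le_of_opNorm_le (norm_fwd_le_of_decay hμ hM t) x)
      map_add' := fun x y => by ext t; simp
      map_smul' := fun c x => by ext t; simp }
    M fun x => by
      have hM0 : 0 ≤ M := by simpa using (norm_nonneg _).trans (hM 0 le_rfl)
      exact BoundedContinuousFunction.norm_ofNormedAddCommGroup_le _ (by positivity)
        fun t => (fwd T t).le_of_opNorm_le (norm_fwd_le_of_decay hμ hM t) x

theorem orbit_apply (hT : IsC0Semigroup T) {M μ : ℝ} (hμ : 0 < μ)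
    (hM : ∀ t, 0 ≤ t → ‖T t‖ ≤ M * Real.exp (-μ * t)) (x : X) (t : ℝ) :
    orbit hT hμ hM x t = fwd T t x := rfl

variable [CompleteSpace X]

theorem IsC0Semigroup.intervalIntegrable_fwd_sub (hT : IsC0Semigroup T) {h : ℝ → X} {a b : ℝ}
    (hh : IntervalIntegrable h volume a b) (t : ℝ) :
    IntervalIntegrable (fun r => fwd T (t - r) (h r)) volume a b := by
  obtain ⟨M, hM1, hM⟩ := hT.exists_bound_fwd (t - min a b)
  rw [intervalIntegrable_iff] at hh ⊢
  refine (hh.norm.const_mul M).mono' ?_ ?_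
  · have h1 : AEStronglyMeasurable (fun r : ℝ => (t - r, h r)) (volume.restrict (Set.uIoc a b)) :=
      (by fun_prop : Continuous fun r : ℝ => t - r).aestronglyMeasurable.prodMk
        hh.aestronglyMeasurable
    exact hT.continuous_fwd.comp_aestronglyMeasurable h1
  · filter_upwards [ae_restrict_mem measurableSet_uIoc] with r hr
    exact (fwd T (t - r)).le_of_opNorm_le (hM _ (by
      have := (Set.uIoc_subset_uIcc hr).1
      simp only [min_def] at *
      linarith)) _

/-- Uniqueness of mild solutions, by Gronwall. Two functions appear because `g` will be a
representative of an `L^p` class, known only almost everywhere, while `u` is the pointwise defined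
right-hand side, which can be evaluated at the endpoint `τ`. -/
theorem IsPerturbation.eq_apply {D : X →L[ℂ] X} {S : ℝ → X →L[ℂ] X} (hT : IsC0Semigroup T)
    (hS : IsC0Semigroup S) (h : IsPerturbation T D S) {x : X} {τ : ℝ} {u g : ℝ → X}
    (hg : IntervalIntegrable g volume 0 τ) (hug : ∀ᵐ t, t ∈ Set.Ioc 0 τ → u t = g t)
    (hu : ∀ t ∈ Set.Icc 0 τ, u t = T t x + ∫ r in (0 : ℝ)..t, fwd T (t - r) (D (g r))) :
    ∀ t ∈ Set.Icc 0 τ, u t = S t x := by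
  rcases lt_or_ge τ 0 with hτ | hτ
  · intro t ht; exact absurd (ht.1.trans ht.2) (not_le.mpr hτ)
  obtain ⟨M, hM1, hM⟩ := hT.exists_bound_fwd τ
  have hsub : ∀ t ∈ Set.Icc 0 τ, Set.uIcc 0 t ⊆ Set.uIcc 0 τ := fun t ht =>
    Set.uIcc_subset_uIcc Set.left_mem_uIcc (by rwa [Set.uIcc_of_le hτ])
  have hSi : ∀ t, IntervalIntegrable (fun r => fwd S r x) volume 0 t := fun t =>
    (hS.continuous_fwd_apply x).intervalIntegrable _ _
  have hDi : ∀ {k : ℝ → X} {t : ℝ}, IntervalIntegrable k volume 0 t →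
      IntervalIntegrable (fun r => D (k r)) volume 0 t := fun hk =>
    ⟨D.integrable_comp hk.1, D.integrable_comp hk.2⟩
  have hae : ∀ t ∈ Set.Icc 0 τ, ∀ᵐ r, r ∈ Set.uIoc 0 t →
      ‖g r - fwd S r x‖ = ‖u r - fwd S r x‖ := by
    intro t ht
    filter_upwards [hug] with r hr hrt
    rw [Set.uIoc_of_le ht.1] at hrt
    rw [hr ⟨hrt.1, hrt.2.trans ht.2⟩]
  have key := eq_zero_of_norm_le_integral (w := fun t => u t - fwd S t x) (c := M * ‖D‖) (τ := τ)
    (by positivity) ?_ ?_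
  · intro t ht
    have := sub_eq_zero.mp (key t ht)
    rwa [fwd_of_nonneg S ht.1] at this
  · refine (hg.sub (hSi τ)).congr_ae ?_
    rw [EventuallyEq, ae_restrict_iff' measurableSet_uIoc, Set.uIoc_of_le hτ]
    filter_upwards [hug] with r hr hrt
    rw [hr hrt]
  · intro t ht
    have hgt := hg.mono_set (hsub t ht)
    have e : u t - fwd S t x =
        ∫ r in (0 : ℝ)..t, fwd T (t - r) (D (g r) - D (fwd S r x)) := by
      rw [hu t ht, fwd_of_nonneg S ht.1, h x t ht.1, add_sub_add_left_eq_sub,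
        ← intervalIntegral.integral_sub (hT.intervalIntegrable_fwd_sub (hDi hgt) t)
          (hT.intervalIntegrable_fwd_sub (hDi (hSi t)) t)]
      simp only [map_sub]
    rw [e]
    refine (norm_integral_fwd_sub_le ht.1 (fun s hs => hM s (hs.trans ht.2))
      ((hDi hgt).sub (hDi (hSi t)))).trans ?_
    rw [mul_assoc, ← intervalIntegral.integral_congr_ae (hae t ht)]
    refine mul_le_mul_of_nonneg_left ?_ (by linarith)
    rw [← intervalIntegral.integral_const_mul]
    refine intervalIntegral.integral_mono_on ht.1 ((hDi hgt).sub (hDi (hSi t))).norm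
      ((hgt.sub (hSi t)).norm.const_mul _) fun r _ => ?_
    rw [← map_sub]
    exact D.le_opNorm _

theorem IsC0Semigroup.continuous_fwd_sub (hT : IsC0Semigroup T) (D : X →L[ℂ] X) {u : ℝ → X}
    (hu : Continuous u) : Continuous fun z : ℝ × ℝ => fwd T (z.1 - z.2) (D (u z.2)) :=
  hT.continuous_fwd.comp (f := fun z : ℝ × ℝ => (z.1 - z.2, D (u z.2))) (by fun_prop)

theorem IsC0Semigroup.continuous_duhamel (hT : IsC0Semigroup T) (D : X →L[ℂ] X) {u : ℝ → X}
    (hu : Continuous u) :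
    Continuous fun t : ℝ => ∫ r in (0 : ℝ)..max t 0, fwd T (max t 0 - r) (D (u r)) := by
  refine intervalIntegral.continuous_parametric_intervalIntegral_of_continuous ?_ (by fun_prop)
  exact (hT.continuous_fwd_sub D hu).comp (f := fun z : ℝ × ℝ => (max z.1 0, z.2)) (by fun_prop)

/-- The Volterra operator `(V u)(t) = ∫₀ᵗ T(t - r) D u(r) dr` for an exponentially decaying `T`. -/
def volterra (hT : IsC0Semigroup T) {M μ : ℝ} (hμ : 0 < μ)
    (hM : ∀ t, 0 ≤ t → ‖T t‖ ≤ M * Real.exp (-μ * t)) (D : X →L[ℂ] X) :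
    (ℝ →ᵇ X) →L[ℂ] (ℝ →ᵇ X) :=
  LinearMap.mkContinuous
    { toFun := fun u => BoundedContinuousFunction.ofNormedAddCommGroup
        (fun t : ℝ => ∫ r in (0 : ℝ)..max t 0, fwd T (max t 0 - r) (D (u r)))
        (hT.continuous_duhamel D u.continuous) (M * ‖D‖ / μ * ‖u‖)
        (fun t => norm_duhamel_le hμ hM D u.norm_coe_le_norm (le_max_right t 0))
      map_add' := fun u v => by
        ext t
        have hi : ∀ u : ℝ →ᵇ X, IntervalIntegrable
            (fun r => fwd T (max t 0 - r) (D (u r))) volume 0 (max t 0) := fun u =>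
          ((hT.continuous_fwd_sub D u.continuous).comp
            (f := fun r : ℝ => (max t 0, r)) (by fun_prop)).intervalIntegrable _ _
        simp only [BoundedContinuousFunction.coe_ofNormedAddCommGroup,
          BoundedContinuousFunction.coe_add, Pi.add_apply, map_add]
        exact intervalIntegral.integral_add (hi u) (hi v)
      map_smul' := fun c u => by
        ext t
        simp only [BoundedContinuousFunction.coe_ofNormedAddCommGroup,
          BoundedContinuousFunction.coe_smul, map_smul, RingHom.id_apply]
        exact intervalIntegral.integral_smul _ _ }
    (M * ‖D‖ / μ) fun u => by
      have hM0 : 0 ≤ M := by simpa using (norm_nonneg _).trans (hM 0 le_rfl)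
      exact BoundedContinuousFunction.norm_ofNormedAddCommGroup_le _ (by positivity)
        fun t => norm_duhamel_le hμ hM D u.norm_coe_le_norm (le_max_right t 0)

theorem volterra_apply (hT : IsC0Semigroup T) {M μ : ℝ} (hμ : 0 < μ)
    (hM : ∀ t, 0 ≤ t → ‖T t‖ ≤ M * Real.exp (-μ * t)) (D : X →L[ℂ] X) (u : ℝ →ᵇ X) (t : ℝ) :
    volterra hT hμ hM D u t = ∫ r in (0 : ℝ)..max t 0, fwd T (max t 0 - r) (D (u r)) := rfl

/-- A shifted solution of the variation of constants formula solves it with the shifted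
initial value. -/
theorem IsC0Semigroup.duhamel_add (hT : IsC0Semigroup T) (D : X →L[ℂ] X) {u : ℝ → X}
    (hu : Continuous u) {x : X}
    (h : ∀ t, 0 ≤ t → u t = T t x + ∫ r in (0 : ℝ)..t, fwd T (t - r) (D (u r)))
    {s t : ℝ} (hs : 0 ≤ s) (ht : 0 ≤ t) :
    u (t + s) = T t (u s) + ∫ r in (0 : ℝ)..t, fwd T (t - r) (D (u (r + s))) := by
  have hc : ∀ t, Continuous fun r => fwd T (t - r) (D (u r)) := fun t =>
    (hT.continuous_fwd_sub D hu).comp (f := fun r : ℝ => (t, r)) (by fun_prop)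
  have e1 : T t (∫ r in (0 : ℝ)..s, fwd T (s - r) (D (u r))) =
      ∫ r in (0 : ℝ)..s, fwd T (t + s - r) (D (u r)) := by
    rw [← ContinuousLinearMap.intervalIntegral_comp_comm _ ((hc s).intervalIntegrable _ _)]
    refine intervalIntegral.integral_congr fun r hr => ?_
    rw [Set.uIcc_of_le hs] at hr
    have h0 : 0 ≤ s - r := by linarith [hr.2]
    rw [fwd_of_nonneg T h0, fwd_of_nonneg T (by linarith), ← hT.map_add_apply ht h0, add_sub_assoc]
  have e2 : (∫ r in (0 : ℝ)..t, fwd T (t - r) (D (u (r + s)))) =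
      ∫ r in s..t + s, fwd T (t + s - r) (D (u r)) := by
    have := intervalIntegral.integral_comp_add_right
      (fun r => fwd T (t + s - r) (D (u r))) s (a := 0) (b := t)
    rw [zero_add] at this
    rw [← this]
    refine intervalIntegral.integral_congr fun r _ => ?_
    rw [add_sub_add_right_eq_sub]
  rw [h s hs, _root_.map_add, e1, e2, h (t + s) (by linarith), hT.map_add_apply ht hs, add_assoc,
    intervalIntegral.integral_add_adjacent_intervals ((hc _).intervalIntegrable _ _)
      ((hc _).intervalIntegrable _ _)]

/-- The hypothesis on `D` makes the Volterra operator a strict contraction, so the orbits of `S`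
come from a Neumann series. The semigroup law is uniqueness: a shifted orbit solves the fixed point
equation of its new initial value. -/
theorem IsC0Semigroup.exists_perturbation_of_decay (hT : IsC0Semigroup T) {M μ : ℝ} (hμ : 0 < μ)
    (hM : ∀ t, 0 ≤ t → ‖T t‖ ≤ M * Real.exp (-μ * t)) {D : X →L[ℂ] X} (hD : M * ‖D‖ < μ) :
    ∃ S, IsC0Semigroup S ∧ IsPerturbation T D S := by
  have hM0 : 0 ≤ M := by simpa using (norm_nonneg _).trans (hM 0 le_rfl)
  have hV : ‖volterra hT hμ hM D‖ < 1 :=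
    (LinearMap.mkContinuous_norm_le _ (by positivity) _).trans_lt ((div_lt_one hμ).mpr hD)
  obtain ⟨W, hW⟩ := isUnit_one_sub_of_norm_lt_one hV
  have hr : ∀ f, (↑W⁻¹ : (ℝ →ᵇ X) →L[ℂ] (ℝ →ᵇ X)) f = f + volterra hT hμ hM D
      ((↑W⁻¹ : (ℝ →ᵇ X) →L[ℂ] (ℝ →ᵇ X)) f) := by
    intro f
    have := congrArg (fun L : (ℝ →ᵇ X) →L[ℂ] (ℝ →ᵇ X) => L f) W.mul_inv
    rw [hW] at this
    exact sub_eq_iff_eq_add.mp this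
  have hl : ∀ f g, f = g + volterra hT hμ hM D f →
      f = (↑W⁻¹ : (ℝ →ᵇ X) →L[ℂ] (ℝ →ᵇ X)) g := by
    intro f g h
    have := congrArg (fun L : (ℝ →ᵇ X) →L[ℂ] (ℝ →ᵇ X) => L f) W.inv_mul
    rw [hW] at this
    have e : (1 - volterra hT hμ hM D) f = g := sub_eq_iff_eq_add.mpr h
    rw [← e]
    exact this.symm
  set U : X → (ℝ →ᵇ X) := fun x => (↑W⁻¹ : (ℝ →ᵇ X) →L[ℂ] (ℝ →ᵇ X)) (orbit hT hμ hM x) with hU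
  let S : ℝ → X →L[ℂ] X := fun t => BoundedContinuousFunction.evalCLM ℂ t ∘L
    (↑W⁻¹ : (ℝ →ᵇ X) →L[ℂ] (ℝ →ᵇ X)) ∘L orbit hT hμ hM
  have hS : ∀ t x, S t x = U x t := fun t x => rfl
  have hvol : ∀ x t, 0 ≤ t → U x t = T t x + ∫ r in (0 : ℝ)..t, fwd T (t - r) (D (U x r)) := by
    intro x t ht
    have := congrArg (fun f : ℝ →ᵇ X => f t) (hr (orbit hT hμ hM x))
    simpa only [BoundedContinuousFunction.add_apply, orbit_apply, volterra_apply, max_eq_left ht,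
      fwd_of_nonneg T ht] using this
  refine ⟨S, ⟨?_, ?_, fun x => (U x).continuous.continuousOn⟩, ?_⟩
  · ext x
    rw [hS, hvol x 0 le_rfl, intervalIntegral.integral_same, add_zero, hT.map_zero]
  · intro s t hs ht
    ext x
    change U x (s + t) = U (U x t) s
    -- Clamping at `0` matches `orbit` and `volterra`, which are constant at negative times, so the
    -- equation for `v` holds on all of `ℝ`.
    let v : ℝ →ᵇ X := (U x).compContinuous ⟨fun r => max r 0 + t, by fun_prop⟩
    have hv : v = orbit hT hμ hM (U x t) + volterra hT hμ hM D v := by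
      ext r
      have h0 := le_max_right r 0
      rw [BoundedContinuousFunction.add_apply, orbit_apply, volterra_apply]
      refine (hT.duhamel_add D (U x).continuous (hvol x) ht h0).trans ?_
      congr 1
      refine intervalIntegral.integral_congr fun q hq => ?_
      rw [Set.uIcc_of_le h0] at hq
      change _ = fwd T (max r 0 - q) (D (U x (max q 0 + t)))
      rw [max_eq_left hq.1]
    have := congrArg (fun f : ℝ →ᵇ X => f s) (hl _ _ hv)
    refine Eq.trans ?_ this
    change U x (s + t) = U x (max s 0 + t)
    rw [max_eq_left hs]
  · intro x t ht
    rw [hS, hvol x t ht]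
    congr 1
    refine intervalIntegral.integral_congr fun q hq => ?_
    rw [Set.uIcc_of_le ht] at hq
    rw [fwd_of_nonneg S hq.1, hS]

/-- Bounded perturbation theorem. -/
theorem IsC0Semigroup.exists_perturbation (hT : IsC0Semigroup T) (D : X →L[ℂ] X) :
    ∃ S, IsC0Semigroup S ∧ IsPerturbation T D S := by
  obtain ⟨M, ω, hM1, hω, hM⟩ := hT.exists_exp_bound
  -- Any `μ > M ‖D‖` would do. Rescaling by `e^{-(ω + μ)t}` creates the decay rate `μ`, and the
  -- inverse rescaling undoes it afterwards.
  set μ : ℝ := M * ‖D‖ + 1 with hμ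
  have hμ0 : 0 < μ := by positivity
  obtain ⟨S, hS, hTS⟩ := (hT.rescale (-((ω + μ : ℝ) : ℂ))).exists_perturbation_of_decay
    (M := M) hμ0 (fun t ht => by
      rw [expRescale, norm_smul, Complex.norm_exp]
      have e : (-((ω + μ : ℝ) : ℂ) * (t : ℂ)).re = -(ω + μ) * t := by
        rw [← Complex.ofReal_neg, ← Complex.ofReal_mul, Complex.ofReal_re]
      rw [e]
      calc _ ≤ Real.exp (-(ω + μ) * t) * (M * Real.exp (ω * t)) := by
            gcongr; exact hM t ht
        _ = M * (Real.exp (-(ω + μ) * t) * Real.exp (ω * t)) := by ring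
        _ = M * Real.exp (-μ * t) := by rw [← Real.exp_add]; ring_nf)
    (D := D) (by linarith)
  refine ⟨expRescale ((ω + μ : ℝ) : ℂ) S, hS.rescale _, ?_⟩
  have := hTS.rescale ((ω + μ : ℝ) : ℂ)
  rwa [rescale_rescale, add_neg_cancel, rescale_zero] at this

/-- The quotient is the average over `[0, t]` of a jointly continuous integrand whose value at the
origin is `D x`. Hence the two generators have the same domain and differ by `D`. -/
theorem IsPerturbation.tendsto_sub {D : X →L[ℂ] X} {S : ℝ → X →L[ℂ] X} (hT : IsC0Semigroup T)
    (hS : IsC0Semigroup S) (h : IsPerturbation T D S) (x : X) :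
    Tendsto (fun t : ℝ => (t : ℂ)⁻¹ • (S t x - T t x)) (𝓝[>] 0) (𝓝 (D x)) := by
  have hcS := hS.continuous_fwd_apply x
  have hc : Continuous fun z : ℝ × ℝ => fwd T (z.1 - z.2) (D (fwd S z.2 x)) :=
    hT.continuous_fwd_sub D hcS
  have h0 : fwd T ((0 : ℝ) - 0) (D (fwd S 0 x)) = D x := by
    rw [sub_zero, fwd_of_nonneg _ le_rfl, fwd_of_nonneg _ le_rfl, hT.map_zero, hS.map_zero]; rfl
  rw [Metric.tendsto_nhdsWithin_nhds]
  intro ε hε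
  obtain ⟨δ, hδ, hδ'⟩ := Metric.continuousAt_iff.mp (hc.continuousAt (x := (0, 0))) (ε / 2)
    (by positivity)
  refine ⟨δ, hδ, fun t ht htδ => ?_⟩
  have ht0 : 0 < t := ht
  rw [Real.dist_eq, sub_zero, abs_of_pos ht0] at htδ
  have hci : IntervalIntegrable (fun r => fwd T (t - r) (D (fwd S r x))) volume 0 t :=
    (hc.comp (f := fun r : ℝ => (t, r)) (by fun_prop)).intervalIntegrable _ _
  have e : (t : ℂ)⁻¹ • (S t x - T t x) - D x =
      (t : ℂ)⁻¹ • ∫ r in (0 : ℝ)..t, (fwd T (t - r) (D (fwd S r x)) - D x) := by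
    rw [intervalIntegral.integral_sub hci intervalIntegrable_const, h x t ht0.le,
      add_sub_cancel_left, intervalIntegral.integral_const, sub_zero, smul_sub,
      ← Complex.coe_smul, smul_smul, inv_mul_cancel₀ (by exact_mod_cast ht0.ne'), one_smul]
  rw [dist_eq_norm, e, norm_smul, norm_inv, Complex.norm_real, Real.norm_of_nonneg ht0.le]
  have hb := intervalIntegral.norm_integral_le_of_norm_le_const (a := 0) (b := t) (C := ε / 2)
    (f := fun r => fwd T (t - r) (D (fwd S r x)) - D x) (fun r hr => by
      rw [Set.uIoc_of_le ht0.le] at hr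
      have h1 : dist (t, r) ((0, 0) : ℝ × ℝ) < δ := by
        rw [Prod.dist_eq, Real.dist_eq, Real.dist_eq]
        simp only [sub_zero, abs_of_pos ht0, abs_of_pos hr.1]
        exact max_lt htδ (hr.2.trans_lt htδ)
      have h2 := hδ' h1
      simp only [h0] at h2
      rw [← dist_eq_norm]
      exact h2.le)
  rw [sub_zero, abs_of_pos ht0] at hb
  calc _ ≤ t⁻¹ * (ε / 2 * t) := by gcongr
    _ = ε / 2 := by field_simp
    _ < ε := by linarith

theorem IsPerturbation.hasGenValue_iff {D : X →L[ℂ] X} {S : ℝ → X →L[ℂ] X} (hT : IsC0Semigroup T)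
    (hS : IsC0Semigroup S) (h : IsPerturbation T D S) {x y : X} :
    HasGenValue S x (D x + y) ↔ HasGenValue T x y := by
  have h1 := h.tendsto_sub hT hS x
  constructor
  · intro h2
    have := Tendsto.sub h2 h1
    rw [add_sub_cancel_left] at this
    refine this.congr fun t => ?_
    rw [← smul_sub]; congr 1; abel
  · intro h2
    refine (h1.add h2).congr fun t => ?_
    rw [← smul_add]; congr 1; abel

theorem IsPerturbation.generator_eq {D : X →L[ℂ] X} {S : ℝ → X →L[ℂ] X} (hT : IsC0Semigroup T)
    (hS : IsC0Semigroup S) (h : IsPerturbation T D S) :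
    generator S = addBounded (generator T) D := by
  refine LinearPMap.ext ?_ ?_
  · ext x
    change (∃ y, HasGenValue S x y) ↔ ∃ y, HasGenValue T x y
    constructor
    · rintro ⟨y, hy⟩
      exact ⟨y - D x, (h.hasGenValue_iff hT hS).1 (by simpa using hy)⟩
    · rintro ⟨y, hy⟩
      exact ⟨_, (h.hasGenValue_iff hT hS).2 hy⟩
  · intro x hx hx'
    exact generator_eq_of_hasGenValue ((h.hasGenValue_iff hT hS).2 (generator_spec T ⟨x, hx'⟩))

end Perturbation

/-! ### The periodic evolution semigroup and the inverse of its generator -/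

section PeriodicEvolution

local notation "𝕋" => AddCircle (2 * Real.pi)

variable {X : Type*} [NormedAddCommGroup X] [NormedSpace ℂ X] {T : ℝ → X →L[ℂ] X}
  {p : ℝ≥0∞} [Fact (1 ≤ p)]

theorem norm_perEvolution_le (T : ℝ → X →L[ℂ] X) (p : ℝ≥0∞) [Fact (1 ≤ p)] (t : ℝ) :
    ‖perEvolution T p t‖ ≤ ‖T t‖ := by
  refine (ContinuousLinearMap.opNorm_comp_le _ _).trans ?_
  refine (mul_le_of_le_one_right (norm_nonneg _) ?_).trans
    (ContinuousLinearMap.norm_compLpL_le (T t))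
  exact LinearIsometry.norm_toContinuousLinearMap_le _

/-- The periodic evolution of a continuous function, as a curve of continuous functions. -/
def contEvolution [CompleteSpace X] (hT : IsC0Semigroup T) (g : C(𝕋, X)) : C(ℝ, C(𝕋, X)) :=
  ContinuousMap.curry ⟨fun z : ℝ × 𝕋 => fwd T z.1 (g (z.2 - ((max z.1 0 : ℝ) : 𝕋))),
    hT.continuous_fwd.comp (f := fun z : ℝ × 𝕋 => (z.1, g (z.2 - ((max z.1 0 : ℝ) : 𝕋))))
      (continuous_fst.prodMk (g.continuous.comp (continuous_snd.sub
        ((AddCircle.continuous_mk' _).comp (continuous_fst.max continuous_const)))))⟩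

theorem contEvolution_apply [CompleteSpace X] (hT : IsC0Semigroup T) (g : C(𝕋, X)) (t : ℝ)
    (s : 𝕋) : contEvolution hT g t s = fwd T t (g (s - ((max t 0 : ℝ) : 𝕋))) := rfl

theorem ae_comp_sub {q : 𝕋 → Prop} (h : ∀ᵐ s, q s) (a : 𝕋) : ∀ᵐ s, q (s - a) :=
  (measurePreserving_sub_right volume a).quasiMeasurePreserving.ae h

theorem fwd_perEvolution_toLp [CompleteSpace X] (hT : IsC0Semigroup T) (g : C(𝕋, X)) (t : ℝ) :
    fwd (perEvolution T p) t (ContinuousMap.toLp p volume ℂ g) =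
      ContinuousMap.toLp p volume ℂ (contEvolution hT g t) := by
  refine Lp.ext ?_
  filter_upwards [perEvolution_apply_ae T p (max t 0) (ContinuousMap.toLp p volume ℂ g),
    ContinuousMap.coeFn_toLp (p := p) (𝕜 := ℂ) volume (contEvolution hT g t),
    ae_comp_sub (ContinuousMap.coeFn_toLp (p := p) (𝕜 := ℂ) volume g) ((max t 0 : ℝ) : 𝕋)]
    with s h1 h2 h3
  rw [h2, contEvolution_apply, ← h3]
  exact h1

/-- For continuous functions the evolution is already a continuous curve in the sup norm. These
functions are dense because `p` is finite, and the local bounds on `T` carry strong continuity to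
all of `L^p`. -/
theorem isC0Semigroup_perEvolution [CompleteSpace X] (hT : IsC0Semigroup T) (hp : p ≠ ∞) :
    IsC0Semigroup (perEvolution T p) where
  map_zero := by
    ext1 f
    refine Lp.ext ?_
    filter_upwards [perEvolution_apply_ae T p 0 f] with s h
    rw [h, hT.map_zero, AddCircle.coe_zero, sub_zero]
    rfl
  map_add s t hs ht := by
    ext1 f
    refine Lp.ext ?_
    filter_upwards [perEvolution_apply_ae T p (s + t) f,
      perEvolution_apply_ae T p s (perEvolution T p t f),
      ae_comp_sub (perEvolution_apply_ae T p t f) (s : 𝕋)] with x h1 h2 h3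
    rw [h1, ContinuousLinearMap.comp_apply, h2, h3, hT.map_add_apply hs ht, AddCircle.coe_add,
      sub_sub]
  continuousOn f := by
    have h : Continuous fun z : ℝ × PerLp X p => fwd (perEvolution T p) z.1 z.2 := by
      refine continuous_uncurry_of_dense
        (ContinuousMap.toLp_denseRange X (volume : Measure 𝕋) ℂ hp) (fun τ => ?_) ?_
      · obtain ⟨M, -, hM⟩ := hT.exists_bound_fwd τ
        exact ⟨M, fun t ht => (norm_perEvolution_le T p _).trans (hM t ht)⟩
      · rintro _ ⟨g, rfl⟩
        simp only [fwd_perEvolution_toLp hT]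
        exact (ContinuousMap.toLp p volume ℂ).continuous.comp (contEvolution hT g).continuous
    have h' : Continuous fun t : ℝ => fwd (perEvolution T p) t f :=
      h.comp (f := fun t : ℝ => (t, f)) (by fun_prop)
    exact h'.continuousOn.congr fun t ht => by
      simp only [fwd_of_nonneg _ (Set.mem_Ici.1 ht)]

theorem perEvolution_two_pi (T : ℝ → X →L[ℂ] X) (p : ℝ≥0∞) [Fact (1 ≤ p)] (f : PerLp X p) :
    perEvolution T p (2 * Real.pi) f = (T (2 * Real.pi)).compLpL p volume f := by
  refine Lp.ext ?_
  filter_upwards [perEvolution_apply_ae T p (2 * Real.pi) f,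
    (T (2 * Real.pi)).coeFn_compLpL (p := p) f] with s h1 h2
  rw [h1, h2, AddCircle.coe_period, sub_zero]

/-- After a full period the rotation disappears, so the inverse can be taken pointwise. The sign of
`-R` arises because `R` inverts `1 - T(2π)`, not `T(2π) - 1`. -/
theorem isResolventAt_perGenerator [CompleteSpace X] (hT : IsC0Semigroup T) (hp : p ≠ ∞)
    {R : X →L[ℂ] X} (h1 : ∀ x, R x - T (2 * Real.pi) (R x) = x)
    (h2 : ∀ x, R (x - T (2 * Real.pi) x) = x) :
    IsResolventAt (perGenerator T p) 0
      (integrated (isC0Semigroup_perEvolution hT hp) (2 * Real.pi) ∘L (-R).compLpL p volume) := by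
  refine (isC0Semigroup_perEvolution hT hp).isResolventAt_zero Real.two_pi_pos.le
    (fun f => ?_) (fun f => ?_)
  · rw [perEvolution_two_pi]
    refine Lp.ext ?_
    filter_upwards [Lp.coeFn_sub ((T (2 * Real.pi)).compLpL p volume ((-R).compLpL p volume f))
        ((-R).compLpL p volume f),
      (T (2 * Real.pi)).coeFn_compLpL (p := p) ((-R).compLpL p volume f),
      (-R).coeFn_compLpL (p := p) f] with s e1 e2 e3
    rw [e1, Pi.sub_apply, e2, e3, neg_apply, map_neg, neg_sub_neg, h1]
  · rw [perEvolution_two_pi]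
    refine Lp.ext ?_
    filter_upwards [Lp.coeFn_sub ((T (2 * Real.pi)).compLpL p volume f) f,
      (T (2 * Real.pi)).coeFn_compLpL (p := p) f,
      (-R).coeFn_compLpL (p := p) ((T (2 * Real.pi)).compLpL p volume f - f)] with s e1 e2 e3
    rw [e3, e1, Pi.sub_apply, e2, neg_apply, ← map_neg, neg_sub, h2]

theorem inverse_comm {S R : X →L[ℂ] X} (h1 : ∀ x, R x - S (R x) = x)
    (h2 : ∀ x, R (x - S x) = x) {L : X →L[ℂ] X} (hL : ∀ x, L (S x) = S (L x)) (x : X) :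
    L (R x) = R (L x) := by
  rw [← h2 (L (R x)), ← hL, ← map_sub, h1]

/-- An `L^p`-valued integral cannot be evaluated at points directly; for continuous `g` it comes
from an integral in `C(𝕋, X)`, where evaluation is a bounded operator. -/
theorem integrated_perEvolution_toLp_ae [CompleteSpace X] (hT : IsC0Semigroup T) (hp : p ≠ ∞)
    (g : C(𝕋, X)) (τ : ℝ) :
    ∀ᵐ s : 𝕋, integrated (isC0Semigroup_perEvolution hT hp) τ (ContinuousMap.toLp p volume ℂ g) s =
      ∫ r in (0 : ℝ)..τ, fwd T r (g (s - ((max r 0 : ℝ) : 𝕋))) := by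
  have hi : IntervalIntegrable (contEvolution hT g) volume 0 τ :=
    (contEvolution hT g).continuous.intervalIntegrable _ _
  have e : integrated (isC0Semigroup_perEvolution hT hp) τ (ContinuousMap.toLp p volume ℂ g) =
      ContinuousMap.toLp p volume ℂ (∫ r in (0 : ℝ)..τ, contEvolution hT g r) := by
    rw [integrated_apply]
    simp only [fwd_perEvolution_toLp hT]
    exact ContinuousLinearMap.intervalIntegral_comp_comm
      (ContinuousMap.toLp p volume ℂ : C(𝕋, X) →L[ℂ] PerLp X p) hi
  rw [e]
  filter_upwards [ContinuousMap.coeFn_toLp (p := p) (𝕜 := ℂ) volume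
    (∫ r in (0 : ℝ)..τ, contEvolution hT g r)] with s hs
  rw [hs]
  exact (ContinuousLinearMap.intervalIntegral_comp_comm
    (ContinuousMap.evalCLM ℂ s : C(𝕋, X) →L[ℂ] X) hi).symm

/-- Split at `s = t` and reflect: the part `s ≤ t` gives `R a`, where `a` is the Duhamel term, and
the part `s ≥ t` wraps around by periodicity. Then `R a = a + R T(τ) a` rearranges the sum. -/
theorem green_identity [CompleteSpace X] (hT : IsC0Semigroup T) {τ : ℝ} {R : X →L[ℂ] X}
    (h1 : ∀ x, R x - T τ (R x) = x) (h2 : ∀ x, R (x - T τ x) = x) {h : ℝ → X} (hh : Continuous h)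
    (hper : Function.Periodic h τ) {t : ℝ} (ht : t ∈ Set.Icc 0 τ) :
    ∫ s in (0 : ℝ)..τ, fwd T s (R (h (t - s))) =
      T t (R (∫ r in (0 : ℝ)..τ, fwd T (τ - r) (h r))) +
        ∫ r in (0 : ℝ)..t, fwd T (t - r) (h r) := by
  have hτ : 0 ≤ τ := ht.1.trans ht.2
  have hc : ∀ s, 0 ≤ s → ∀ x, T s (R x) = R (T s x) := fun s hs =>
    inverse_comm h1 h2 (hT.comm_apply hs hτ)
  have hcF : ∀ s x, fwd T s (R x) = R (fwd T s x) := fun s => hc _ (le_max_right s 0)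
  have hcont : ∀ a, Continuous fun r => fwd T (a - r) (h r) := fun a =>
    (hT.continuous_fwd_sub (ContinuousLinearMap.id ℂ X) hh).comp
      (f := fun r : ℝ => (a, r)) (by fun_prop)
  have hi : ∀ a b c, IntervalIntegrable (fun r => fwd T (a - r) (h r)) volume b c := fun a b c =>
    (hcont a).intervalIntegrable _ _
  have hcF' : Continuous fun s => fwd T s (R (h (t - s))) :=
    hT.continuous_fwd.comp (f := fun s : ℝ => (s, R (h (t - s)))) (by fun_prop)
  have e1 : ∫ s in (0 : ℝ)..t, fwd T s (R (h (t - s))) =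
      R (∫ r in (0 : ℝ)..t, fwd T (t - r) (h r)) := by
    rw [← ContinuousLinearMap.intervalIntegral_comp_comm _ (hi _ _ _)]
    have := intervalIntegral.integral_comp_sub_left
      (fun r => R (fwd T (t - r) (h r))) t (a := 0) (b := t)
    rw [sub_self, sub_zero] at this
    rw [← this]
    refine intervalIntegral.integral_congr fun s _ => ?_
    simp only [sub_sub_cancel, hcF]
  have e2 : ∫ s in t..τ, fwd T s (R (h (t - s))) =
      R (T t (∫ r in t..τ, fwd T (τ - r) (h r))) := by
    have hTi : IntervalIntegrable (fun r => T t (fwd T (τ - r) (h r))) volume t τ :=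
      ((T t).continuous.comp (hcont τ)).intervalIntegrable _ _
    rw [← ContinuousLinearMap.intervalIntegral_comp_comm _ (hi _ _ _),
      ← ContinuousLinearMap.intervalIntegral_comp_comm _ hTi]
    have := intervalIntegral.integral_comp_sub_left
      (fun r => R (T t (fwd T (τ - r) (h r)))) (t + τ) (a := t) (b := τ)
    rw [add_sub_cancel_left, add_sub_cancel_right] at this
    rw [← this]
    refine intervalIntegral.integral_congr fun s hs => ?_
    rw [Set.uIcc_of_le ht.2] at hs
    have h0 : 0 ≤ τ - (t + τ - s) := by linarith [hs.1]
    have h3 : h (t + τ - s) = h (t - s) := by rw [← hper (t - s)]; congr 1; ring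
    change _ = R (T t (fwd T (τ - (t + τ - s)) (h (t + τ - s))))
    rw [hcF, h3, fwd_of_nonneg _ h0, ← hT.map_add_apply ht.1 h0,
      fwd_of_nonneg _ (ht.1.trans hs.1)]
    congr 3; ring
  have e3 : T t (∫ r in (0 : ℝ)..t, fwd T (τ - r) (h r)) =
      T τ (∫ r in (0 : ℝ)..t, fwd T (t - r) (h r)) := by
    rw [← ContinuousLinearMap.intervalIntegral_comp_comm _ (hi _ _ _),
      ← ContinuousLinearMap.intervalIntegral_comp_comm _ (hi _ _ _)]
    refine intervalIntegral.integral_congr fun r hr => ?_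
    rw [Set.uIcc_of_le ht.1] at hr
    have h0 : 0 ≤ t - r := by linarith [hr.2]
    have h3 : 0 ≤ τ - r := by linarith [hr.2, ht.2]
    change T t (fwd T (τ - r) (h r)) = T τ (fwd T (t - r) (h r))
    rw [fwd_of_nonneg _ h0, fwd_of_nonneg _ h3, ← hT.map_add_apply ht.1 h3,
      ← hT.map_add_apply hτ h0]
    congr 2; ring
  rw [← intervalIntegral.integral_add_adjacent_intervals (hcF'.intervalIntegrable 0 t)
    (hcF'.intervalIntegrable t τ), e1, e2,
    ← intervalIntegral.integral_add_adjacent_intervals (hi τ 0 t) (hi τ t τ)]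
  simp only [map_add]
  rw [hc t ht.1, hc t ht.1, e3]
  have := h2 (∫ r in (0 : ℝ)..t, fwd T (t - r) (h r))
  rw [map_sub, sub_eq_iff_eq_add'] at this
  nth_rewrite 1 [this]
  abel

theorem ae_lift {q : 𝕋 → Prop} (h : ∀ᵐ s, q s) :
    ∀ᵐ r : ℝ, r ∈ Set.Ioc 0 (2 * Real.pi) → q (r : 𝕋) := by
  have := (AddCircle.measurePreserving_mk (2 * Real.pi) 0).quasiMeasurePreserving.ae h
  rwa [ae_restrict_iff' measurableSet_Ioc, zero_add] at this

theorem ae_of_ae_lift {q : 𝕋 → Prop} (hq : MeasurableSet {s | q s})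
    (h : ∀ᵐ r : ℝ, r ∈ Set.Ioc 0 (2 * Real.pi) → q (r : 𝕋)) : ∀ᵐ s, q s := by
  rw [← (AddCircle.measurePreserving_mk (2 * Real.pi) 0).map_eq,
    ae_map_iff (AddCircle.measurePreserving_mk (2 * Real.pi) 0).aemeasurable hq,
    ae_restrict_iff' measurableSet_Ioc, zero_add]
  exact h

theorem intervalIntegrable_lift {E : Type*} [NormedAddCommGroup E] {f : 𝕋 → E} (hf : Integrable f) :
    IntervalIntegrable (fun r : ℝ => f r) volume 0 (2 * Real.pi) := by
  have := (AddCircle.measurePreserving_mk (2 * Real.pi) 0).integrable_comp_of_integrable hf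
  rw [zero_add] at this
  rwa [intervalIntegrable_iff_integrableOn_Ioc_of_le Real.two_pi_pos.le]

theorem integrable_perLp {E : Type*} [NormedAddCommGroup E] (f : PerLp E p) : Integrable f :=
  (Lp.memLp f).integrable Fact.out

/-- Hölder on a space of finite measure: `L^p` convergence controls the integrals in the Duhamel
terms. -/
theorem exists_integral_norm_sub_le (X : Type*) [NormedAddCommGroup X] (p : ℝ≥0∞)
    [Fact (1 ≤ p)] :
    ∃ K : ℝ, ∀ f g : PerLp X p,
      ∫ r in (0 : ℝ)..2 * Real.pi, ‖f (r : 𝕋) - g (r : 𝕋)‖ ≤ K * ‖f - g‖ := by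
  set c : ℝ≥0∞ := (volume (Set.univ : Set 𝕋)) ^ (1 / (1 : ℝ≥0∞).toReal - 1 / p.toReal) with hc
  have hc0 : c ≠ ∞ := by
    refine ENNReal.rpow_ne_top_of_nonneg ?_ (measure_ne_top _ _)
    rcases eq_or_ne p ∞ with rfl | hp
    · simp
    · have h1 : (1 : ℝ) ≤ p.toReal := by
        simpa using ENNReal.toReal_mono hp (Fact.out : 1 ≤ p)
      simp only [ENNReal.toReal_one, div_one, sub_nonneg]
      exact (div_le_one (by linarith)).2 h1
  refine ⟨c.toReal, fun f g => ?_⟩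
  have e1 : ∫ r in (0 : ℝ)..2 * Real.pi, ‖f (r : 𝕋) - g (r : 𝕋)‖ = ∫ s : 𝕋, ‖(f - g) s‖ := by
    have := AddCircle.intervalIntegral_preimage (2 * Real.pi) 0 fun s : 𝕋 => ‖f s - g s‖
    rw [zero_add] at this
    rw [this]
    refine integral_congr_ae ?_
    filter_upwards [Lp.coeFn_sub f g] with s hs
    rw [hs, Pi.sub_apply]
  rw [e1, integral_norm_eq_lintegral_enorm (Lp.aestronglyMeasurable _),
    ← eLpNorm_one_eq_lintegral_enorm, Lp.norm_def, mul_comm c.toReal, ← ENNReal.toReal_mul]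
  exact ENNReal.toReal_mono (ENNReal.mul_ne_top (Lp.eLpNorm_ne_top _) hc0)
    (eLpNorm_le_eLpNorm_mul_rpow_measure_univ Fact.out (Lp.aestronglyMeasurable _))

theorem IsC0Semigroup.tendsto_duhamel [CompleteSpace X] (hT : IsC0Semigroup T)
    {fn : ℕ → PerLp X p} {f : PerLp X p} (h : Tendsto fn atTop (𝓝 f)) {t : ℝ}
    (ht : t ∈ Set.Icc 0 (2 * Real.pi)) :
    Tendsto (fun n => ∫ r in (0 : ℝ)..t, fwd T (t - r) (fn n (r : 𝕋))) atTop
      (𝓝 (∫ r in (0 : ℝ)..t, fwd T (t - r) (f (r : 𝕋)))) := by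
  obtain ⟨M, hM1, hM⟩ := hT.exists_bound_fwd t
  obtain ⟨K, hK⟩ := exists_integral_norm_sub_le X p
  have hsub : Set.uIcc 0 t ⊆ Set.uIcc 0 (2 * Real.pi) :=
    Set.uIcc_subset_uIcc Set.left_mem_uIcc (by rwa [Set.uIcc_of_le Real.two_pi_pos.le])
  have hi : ∀ g : PerLp X p, IntervalIntegrable (fun r : ℝ => g (r : 𝕋)) volume 0 t := fun g =>
    (intervalIntegrable_lift (integrable_perLp g)).mono_set hsub
  rw [tendsto_iff_norm_sub_tendsto_zero] at h ⊢
  refine squeeze_zero (fun _ => norm_nonneg _) (fun n => ?_)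
    (by simpa using h.const_mul (M * K))
  rw [← intervalIntegral.integral_sub (hT.intervalIntegrable_fwd_sub (hi _) t)
    (hT.intervalIntegrable_fwd_sub (hi _) t)]
  simp only [← map_sub]
  refine (norm_integral_fwd_sub_le ht.1 hM ((hi _).sub (hi _))).trans ?_
  rw [mul_assoc]
  refine mul_le_mul_of_nonneg_left ((?_ : _ ≤ _).trans (hK (fn n) f)) (by linarith)
  refine intervalIntegral.integral_mono_interval le_rfl ht.1 ht.2
    (Eventually.of_forall fun _ => norm_nonneg _) ?_
  exact ((intervalIntegrable_lift (integrable_perLp _)).sub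
    (intervalIntegrable_lift (integrable_perLp _))).norm

/-- The inverse of `Γ_per` is given, up to sign, by the periodic Green function. -/
theorem resolventOp_perGenerator_ae [CompleteSpace X] (hT : IsC0Semigroup T) (hp : p ≠ ∞)
    {R : X →L[ℂ] X} (h1 : ∀ x, R x - T (2 * Real.pi) (R x) = x)
    (h2 : ∀ x, R (x - T (2 * Real.pi) x) = x) (f : PerLp X p) :
    ∀ᵐ t : ℝ, t ∈ Set.Ioc 0 (2 * Real.pi) → resolventOp (perGenerator T p) 0 f (t : 𝕋) =
      -(T t (R (∫ r in (0 : ℝ)..2 * Real.pi, fwd T (2 * Real.pi - r) (f (r : 𝕋)))) +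
        ∫ r in (0 : ℝ)..t, fwd T (t - r) (f (r : 𝕋))) := by
  rw [(isResolventAt_perGenerator hT hp h1 h2).resolventOp_eq]
  set G := integrated (isC0Semigroup_perEvolution hT hp) (2 * Real.pi) ∘L
    (-R).compLpL p volume with hG
  have hcont : ∀ g : C(𝕋, X), ∀ᵐ t : ℝ, t ∈ Set.Ioc 0 (2 * Real.pi) →
      G (ContinuousMap.toLp p volume ℂ g) (t : 𝕋) =
      -(T t (R (∫ r in (0 : ℝ)..2 * Real.pi, fwd T (2 * Real.pi - r)
        (ContinuousMap.toLp p volume ℂ g (r : 𝕋)))) +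
        ∫ r in (0 : ℝ)..t, fwd T (t - r) (ContinuousMap.toLp p volume ℂ g (r : 𝕋))) := by
    intro g
    have e : (-R).compLpL p volume (ContinuousMap.toLp p volume ℂ g) =
        ContinuousMap.toLp p volume ℂ ((⟨-R, (-R).continuous⟩ : C(X, X)).comp g) := by
      refine Lp.ext ?_
      filter_upwards [(-R).coeFn_compLpL (p := p) (ContinuousMap.toLp p volume ℂ g),
        ContinuousMap.coeFn_toLp (p := p) (𝕜 := ℂ) volume g,
        ContinuousMap.coeFn_toLp (p := p) (𝕜 := ℂ) volume
          ((⟨-R, (-R).continuous⟩ : C(X, X)).comp g)] with s e1 e2 e3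
      rw [e1, e2, e3]; rfl
    have hg := ae_lift (ContinuousMap.coeFn_toLp (p := p) (𝕜 := ℂ) volume g)
    have hcongr : ∀ t ∈ Set.Icc 0 (2 * Real.pi),
        ∫ r in (0 : ℝ)..t, fwd T (t - r) (ContinuousMap.toLp p volume ℂ g (r : 𝕋)) =
          ∫ r in (0 : ℝ)..t, fwd T (t - r) (g (r : 𝕋)) := by
      intro t ht
      refine intervalIntegral.integral_congr_ae ?_
      filter_upwards [hg] with r hr hrt
      rw [Set.uIoc_of_le ht.1] at hrt
      rw [hr ⟨hrt.1, hrt.2.trans ht.2⟩]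
    rw [hG, ContinuousLinearMap.comp_apply, e]
    filter_upwards [ae_lift (integrated_perEvolution_toLp_ae hT hp
      ((⟨-R, (-R).continuous⟩ : C(X, X)).comp g) (2 * Real.pi))] with t ht htm
    have htm' : t ∈ Set.Icc 0 (2 * Real.pi) := ⟨htm.1.le, htm.2⟩
    rw [ht htm, hcongr t htm', hcongr _ (Set.right_mem_Icc.2 Real.two_pi_pos.le)]
    rw [← green_identity hT h1 h2 (h := fun r : ℝ => g (r : 𝕋))
      (g.continuous.comp (AddCircle.continuous_mk' _))
      (fun r => by simp only [AddCircle.coe_add, AddCircle.coe_period, add_zero]) htm',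
      ← intervalIntegral.integral_neg]
    refine intervalIntegral.integral_congr fun s hs => ?_
    rw [Set.uIcc_of_le Real.two_pi_pos.le] at hs
    change fwd T s (-R (g ((t : 𝕋) - ((max s 0 : ℝ) : 𝕋)))) = -fwd T s (R (g ((t - s : ℝ) : 𝕋)))
    rw [max_eq_left hs.1, map_neg, AddCircle.coe_sub]
  -- Approximation by continuous functions: a subsequence of the left sides converges almost
  -- everywhere, while the right sides converge at every `t` in `[0, 2π]`.
  obtain ⟨fn, hfn, hlim⟩ := mem_closure_iff_seq_limit.1
    (ContinuousMap.toLp_denseRange X (volume : Measure 𝕋) ℂ hp f)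
  choose g hg using hfn
  obtain ⟨ns, hns, hae⟩ := (tendstoInMeasure_of_tendsto_Lp
    ((G.continuous.tendsto f).comp hlim)).exists_seq_tendsto_ae
  filter_upwards [ae_lift hae, ae_all_iff.2 fun n => hcont (g n)] with t h3 h4 htm
  have hlim' := hlim.comp hns.tendsto_atTop
  have htm' : t ∈ Set.Icc 0 (2 * Real.pi) := ⟨htm.1.le, htm.2⟩
  refine tendsto_nhds_unique (h3 htm) ?_
  have h5 := ((((T t).continuous.comp R.continuous).tendsto _).comp
    (hT.tendsto_duhamel hlim' (Set.right_mem_Icc.2 Real.two_pi_pos.le))).add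
      (hT.tendsto_duhamel hlim' htm')
  refine h5.neg.congr fun n => ?_
  have h6 := h4 (ns n) htm
  rw [hg] at h6
  exact h6.symm

end PeriodicEvolution

/-! ### The two bounds for the stability radius -/

section Bounds

local notation "𝕋" => AddCircle (2 * Real.pi)

theorem perLp_ext_of_ae_lift {E : Type*} [NormedAddCommGroup E] {p : ℝ≥0∞} {f g : PerLp E p}
    (h : ∀ᵐ r : ℝ, r ∈ Set.Ioc 0 (2 * Real.pi) → f (r : 𝕋) = g (r : 𝕋)) : f = g :=
  Lp.ext <| ae_of_ae_lift
    ((Lp.stronglyMeasurable f).measurableSet_eq_fun (Lp.stronglyMeasurable g)) h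

/-- Since `k` need not be periodic, the function on the circle may jump at `0`; it is still bounded
and measurable. -/
theorem exists_perLp_ae_lift_eq {E : Type*} [NormedAddCommGroup E] (p : ℝ≥0∞) {k : ℝ → E}
    (hk : Continuous k) :
    ∃ f : PerLp E p, ∀ᵐ r : ℝ, r ∈ Set.Ioc 0 (2 * Real.pi) → f (r : 𝕋) = k r := by
  obtain ⟨M, hM⟩ := (isCompact_Icc (a := (0 : ℝ)) (b := 2 * Real.pi)).exists_bound_of_continuousOn
    hk.continuousOn
  have hm : StronglyMeasurable fun s : 𝕋 => k (AddCircle.measurableEquivIoc (2 * Real.pi) 0 s) :=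
    hk.stronglyMeasurable.comp_measurable
      (measurable_subtype_coe.comp (AddCircle.measurableEquivIoc (2 * Real.pi) 0).measurable)
  have hmem : MemLp (fun s : 𝕋 => k (AddCircle.measurableEquivIoc (2 * Real.pi) 0 s)) p
      (volume : Measure 𝕋) := by
    refine MemLp.of_bound hm.aestronglyMeasurable M (Eventually.of_forall fun s => hM _ ?_)
    have := (AddCircle.measurableEquivIoc (2 * Real.pi) 0 s).2
    exact ⟨this.1.le, this.2.trans_eq (zero_add _)⟩
  refine ⟨hmem.toLp, ?_⟩
  filter_upwards [ae_lift hmem.coeFn_toLp] with r hr hrt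
  rw [hr hrt]
  exact AddCircle.liftIoc_coe_apply (p := 2 * Real.pi) (a := 0) (f := k) (by rwa [zero_add])

/-- `1 + PQ` is invertible as soon as `1 + QP` is, with solution `f = z - P (1 + QP)⁻¹ Q z`. So only
the input-output loop `Q P` must be small, not `P Q` on the state space. -/
theorem existsUnique_add_comp_eq {E F : Type*} [NormedAddCommGroup E] [NormedSpace ℂ E]
    [NormedAddCommGroup F] [NormedSpace ℂ F] [CompleteSpace F] {P : F →L[ℂ] E} {Q : E →L[ℂ] F}
    (h : ‖Q ∘L P‖ < 1) (z : E) : ∃! f, f + P (Q f) = z := by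
  obtain ⟨W, hW⟩ := isUnit_one_sub_of_norm_lt_one (x := -(Q ∘L P)) (by rwa [norm_neg])
  have hW1 : ∀ w, w + Q (P w) = (W : F →L[ℂ] F) w := by
    intro w; rw [hW]; simp
  have hr : ∀ w, (W : F →L[ℂ] F) ((↑W⁻¹ : F →L[ℂ] F) w) = w := fun w =>
    congrArg (fun L : F →L[ℂ] F => L w) W.mul_inv
  have hl : ∀ w, (↑W⁻¹ : F →L[ℂ] F) ((W : F →L[ℂ] F) w) = w := fun w =>
    congrArg (fun L : F →L[ℂ] F => L w) W.inv_mul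
  set w := (↑W⁻¹ : F →L[ℂ] F) (Q z) with hw
  have e : w + Q (P w) = Q z := by rw [hW1, hw, hr]
  refine ⟨z - P w, ?_, fun f hf => ?_⟩
  · simp only [map_sub]
    rw [← map_sub, ← e, add_sub_cancel_right, sub_add_cancel]
  · have e2 : Q f = w := by
      rw [hw, ← hl (Q f), ← hW1, ← map_add, hf]
    rw [← hf, e2, add_sub_cancel_right]

variable {X : Type*} [NormedAddCommGroup X] [NormedSpace ℂ X] [CompleteSpace X]
  {U : Type*} [NormedAddCommGroup U] [NormedSpace ℂ U]
  {Y : Type*} [NormedAddCommGroup Y] [NormedSpace ℂ Y]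
  {T : ℝ → X →L[ℂ] X} {p : ℝ≥0∞} [Fact (1 ≤ p)]

theorem one_mem_resolventSet_of_isPerturbation [CompleteSpace U] (hT : IsC0Semigroup T)
    (h1 : (1 : ℂ) ∈ resolventSet ℂ (T (2 * Real.pi))) (hp : p ≠ ∞)
    (B : U →L[ℂ] X) (C : X →L[ℂ] Y) {Δ : Y →L[ℂ] U} (hΔ : ‖Δ‖ * ‖perInputOutput T p B C‖ < 1)
    {S : ℝ → X →L[ℂ] X} (hS : IsC0Semigroup S) (hTS : IsPerturbation T (B ∘L Δ ∘L C) S) :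
    (1 : ℂ) ∈ resolventSet ℂ (S (2 * Real.pi)) := by
  obtain ⟨R, hR1, hR2⟩ := exists_inverse_of_mem_resolventSet h1
  set D : X →L[ℂ] X := B ∘L Δ ∘L C with hD
  set G := resolventOp (perGenerator T p) 0 with hG
  set P : PerLp U p →L[ℂ] PerLp X p := G ∘L B.compLpL p volume with hP
  set Q : PerLp X p →L[ℂ] PerLp U p := Δ.compLpL p volume ∘L C.compLpL p volume with hQ
  have hπ := Real.two_pi_pos
  have hlt : ‖Q ∘L P‖ < 1 := by
    refine lt_of_le_of_lt ?_ hΔ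
    refine (ContinuousLinearMap.opNorm_comp_le (Δ.compLpL p volume)
      (perInputOutput T p B C)).trans ?_
    exact mul_le_mul_of_nonneg_right (ContinuousLinearMap.norm_compLpL_le Δ) (norm_nonneg _)
  have hae : ∀ f : PerLp X p, ∀ᵐ r : ℝ, r ∈ Set.Ioc 0 (2 * Real.pi) →
      B.compLpL p volume (Q f) (r : 𝕋) = D (f (r : 𝕋)) := by
    intro f
    refine ae_lift (q := fun s => B.compLpL p volume (Q f) s = D (f s)) ?_
    filter_upwards [B.coeFn_compLpL (p := p) (Q f),
      Δ.coeFn_compLpL (p := p) (C.compLpL p volume f), C.coeFn_compLpL (p := p) f]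
      with s e1 e2 e3
    rw [e1, hQ, ContinuousLinearMap.comp_apply, e2, e3]; rfl
  have hint : ∀ (f : PerLp X p) (k : ℝ → X),
      (∀ᵐ r : ℝ, r ∈ Set.Ioc 0 (2 * Real.pi) → f (r : 𝕋) = k r) →
      ∀ t ∈ Set.Icc 0 (2 * Real.pi),
      ∫ r in (0 : ℝ)..t, fwd T (t - r) (B.compLpL p volume (Q f) (r : 𝕋)) =
        ∫ r in (0 : ℝ)..t, fwd T (t - r) (D (k r)) := by
    intro f k hk t ht
    refine intervalIntegral.integral_congr_ae ?_
    filter_upwards [hae f, hk] with r h3 h4 hrt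
    rw [Set.uIoc_of_le ht.1] at hrt
    have h5 : r ∈ Set.Ioc 0 (2 * Real.pi) := ⟨hrt.1, hrt.2.trans ht.2⟩
    rw [h3 h5, h4 h5]
  have hPQ : ∀ (f : PerLp X p) (k : ℝ → X),
      (∀ᵐ r : ℝ, r ∈ Set.Ioc 0 (2 * Real.pi) → f (r : 𝕋) = k r) →
      ∀ᵐ t : ℝ, t ∈ Set.Ioc 0 (2 * Real.pi) → P (Q f) (t : 𝕋) =
      -(T t (R (∫ r in (0 : ℝ)..2 * Real.pi, fwd T (2 * Real.pi - r) (D (k r)))) +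
        ∫ r in (0 : ℝ)..t, fwd T (t - r) (D (k r))) := by
    intro f k hk
    filter_upwards [resolventOp_perGenerator_ae hT hp hR1 hR2 (B.compLpL p volume (Q f))]
      with t ht htm
    rw [← hint f k hk t ⟨htm.1.le, htm.2⟩, ← hint f k hk _ (Set.right_mem_Icc.2 hπ.le), ← ht htm]
    rfl
  have hmem : (2 * Real.pi) ∈ Set.Icc 0 (2 * Real.pi) := Set.right_mem_Icc.2 hπ.le
  have hbij : Function.Bijective (1 - S (2 * Real.pi) : X →L[ℂ] X) := by
    constructor
    · rw [injective_iff_map_eq_zero]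
      intro x hx
      have hx' : S (2 * Real.pi) x = x := (sub_eq_zero.mp hx).symm
      -- The `S`-orbit of a fixed point is a periodic mild solution, hence lies in the kernel of `1
      -- + P Q`.
      obtain ⟨f, hf⟩ := exists_perLp_ae_lift_eq p (hS.continuous_fwd_apply x)
      have hI : R (∫ r in (0 : ℝ)..2 * Real.pi, fwd T (2 * Real.pi - r) (D (fwd S r x))) = x := by
        have := hTS x _ hπ.le
        rw [hx', ← sub_eq_iff_eq_add'] at this
        rw [← this, hR2]
      have h0 : f + P (Q f) = 0 := by
        refine perLp_ext_of_ae_lift ?_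
        filter_upwards [hf, hPQ f _ hf, ae_lift (Lp.coeFn_add f (P (Q f))),
          ae_lift (Lp.coeFn_zero X p (volume : Measure 𝕋))] with t e1 e2 e3 e4 htm
        rw [e3 htm, e4 htm, Pi.add_apply, e1 htm, e2 htm, hI, ← hTS x t htm.1.le,
          fwd_of_nonneg S htm.1.le, add_neg_cancel]
        rfl
      have hf0 : f = 0 := (existsUnique_add_comp_eq hlt 0).unique h0 (by simp)
      have hz : (fun t => fwd S t x) =ᵐ[volume.restrict (Set.Ioc 0 (2 * Real.pi))] fun _ => 0 := by
        rw [EventuallyEq, ae_restrict_iff' measurableSet_Ioc]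
        filter_upwards [hf, ae_lift (Lp.coeFn_zero X p (volume : Measure 𝕋))] with t e1 e2 htm
        rw [← e1 htm, hf0, e2 htm]
        rfl
      -- The continuous orbit vanishes on all of `(0, 2π]`; this interval contains `2π`, where the
      -- orbit returns to `x`.
      have := Measure.eqOn_Ioc_of_ae_eq volume hz
        (hS.continuous_fwd_apply x).continuousOn continuousOn_const
        (Set.right_mem_Ioc.2 hπ)
      simp only [fwd_of_nonneg S hπ.le, hx'] at this
      exact this
    · intro y
      -- With this `z`, the solution `f` satisfies the variation of constants formula with initial
      -- value `x = R (y + I)`. Thus `S(2π) x = T(2π) x + I`, and `x - T(2π) x = y + I` leaves `y`.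
      obtain ⟨z, hz⟩ := exists_perLp_ae_lift_eq p (hT.continuous_fwd_apply (R y))
      obtain ⟨f, hf, -⟩ := existsUnique_add_comp_eq hlt z
      set k : ℝ → X := fun r => f (r : 𝕋) with hk
      set I := ∫ r in (0 : ℝ)..2 * Real.pi, fwd T (2 * Real.pi - r) (D (k r)) with hI
      set x := R (y + I) with hx
      have hu := hTS.eq_apply hT hS (x := x) (τ := 2 * Real.pi) (g := k)
        (u := fun t => T t x + ∫ r in (0 : ℝ)..t, fwd T (t - r) (D (k r)))
        (intervalIntegrable_lift (integrable_perLp f)) ?_ (fun t _ => rfl) _ hmem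
      · refine ⟨x, ?_⟩
        change x - S (2 * Real.pi) x = y
        rw [← hu]
        have := hR1 (y + I)
        rw [← hx] at this
        change x - (T (2 * Real.pi) x + I) = y
        rw [← sub_sub, this, add_sub_cancel_right]
      · filter_upwards [hz, hPQ f k (Eventually.of_forall fun _ _ => rfl),
          ae_lift (Lp.coeFn_add f (P (Q f)))] with t e1 e2 e3 htm
        have e4 := e3 htm
        rw [hf, e1 htm, Pi.add_apply, e2 htm, fwd_of_nonneg T htm.1.le] at e4
        change _ = f (t : 𝕋)
        rw [← sub_eq_add_neg, eq_sub_iff_add_eq] at e4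
        rw [← e4, hx, map_add, map_add, add_assoc]
  rw [spectrum.mem_resolventSet_iff, map_one]
  exact ContinuousLinearMap.isUnit_iff_bijective.2 hbij

theorem inv_norm_perInputOutput_le_pointwiseStabRadius [CompleteSpace U] (hT : IsC0Semigroup T)
    (h1 : (1 : ℂ) ∈ resolventSet ℂ (T (2 * Real.pi))) (hp : p ≠ ∞)
    (B : U →L[ℂ] X) (C : X →L[ℂ] Y) :
    1 / ‖perInputOutput T p B C‖ₑ ≤
      pointwiseStabRadius 1 (2 * Real.pi) (generator T) B C := by
  refine le_of_forall_lt fun a ha => ?_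
  -- A radius strictly below the bound gives the strict small-gain inequality, and it is finite even
  -- when the bound is `1/0 = ∞`.
  obtain ⟨b, hab, hb⟩ := exists_between ha
  refine hab.trans_le (le_sSup ?_)
  have hbt : b ≠ ∞ := hb.ne_top
  have hb0 : 0 < b.toReal := ENNReal.toReal_pos (bot_le.trans_lt hab).ne' hbt
  refine ⟨b.toReal, hb0, (ENNReal.ofReal_toReal hbt).symm, fun Δ hΔ => ?_⟩
  have hlt : b.toReal * ‖perInputOutput T p B C‖ < 1 := by
    have h2 : b * ‖perInputOutput T p B C‖ₑ < 1 := by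
      rcases eq_or_ne ‖perInputOutput T p B C‖ₑ 0 with h0 | h0
      · simp [h0]
      · exact (ENNReal.lt_div_iff_mul_lt (Or.inl h0) (Or.inl enorm_ne_top)).1 hb
    have h3 := (ENNReal.toReal_lt_toReal h2.ne_top ENNReal.one_ne_top).2 h2
    rwa [ENNReal.toReal_mul, toReal_enorm, ENNReal.toReal_one] at h3
  obtain ⟨S, hS, hTS⟩ := hT.exists_perturbation (B ∘L Δ ∘L C)
  refine ⟨S, hS, hTS.generator_eq hT hS, ?_⟩
  exact one_mem_resolventSet_of_isPerturbation hT h1 hp B C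
    ((mul_le_mul_of_nonneg_right hΔ (norm_nonneg _)).trans_lt hlt) hS hTS

/-- A violation at `v` yields a rank-one perturbation for which `x = (A - ik)⁻¹ B v` is an
eigenvector with eigenvalue `ik`, against spectral inclusion for the perturbed semigroup. -/
theorem norm_transferFn_le (B : U →L[ℂ] X) (C : X →L[ℂ] Y) {A : X →ₗ.[ℂ] X} {r : ℝ} (hr : 0 < r)
    {k : ℤ} (hA : InResolventSet A (Complex.I * k))
    (h : ∀ Δ : Y →L[ℂ] U, ‖Δ‖ ≤ r →
      InResolventSetExp (addBounded A (B ∘L Δ ∘L C)) (2 * Real.pi) 1) :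
    ‖transferFn A B C (Complex.I * k)‖ ≤ r⁻¹ := by
  refine ContinuousLinearMap.opNorm_le_bound _ (inv_nonneg.2 hr.le) fun v => ?_
  by_contra! hlt
  obtain ⟨Q, hQ⟩ := hA
  set x := Q (B v) with hx
  set y := transferFn A B C (Complex.I * k) v with hy
  have hyx : y = C x := by
    rw [hy, transferFn, hQ.resolventOp_eq]; rfl
  have hy0 : 0 < ‖y‖ := (by positivity : 0 ≤ r⁻¹ * ‖v‖).trans_lt hlt
  obtain ⟨φ, hφ, hφy⟩ := exists_dual_vector ℂ y hy0.ne'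
  have hyc : (‖y‖ : ℂ) ≠ 0 := by exact_mod_cast hy0.ne'
  -- Chosen so that `Δ y = -v`, which cancels `B v = (A - ik) x`; as `φ` has norm one, `‖Δ‖ = ‖v‖ /
  -- ‖y‖`.
  set Δ : Y →L[ℂ] U := φ.smulRight (-(‖y‖ : ℂ)⁻¹ • v) with hΔ
  have hΔy : Δ y = -v := by
    rw [hΔ, ContinuousLinearMap.smulRight_apply, hφy, smul_smul]
    simp [hyc]
  have hΔr : ‖Δ‖ ≤ r := by
    rw [hΔ, ContinuousLinearMap.norm_smulRight_apply, hφ, one_mul, norm_smul, norm_neg, norm_inv,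
      Complex.norm_real, norm_norm, inv_mul_le_iff₀ hy0, mul_comm]
    exact (le_of_lt ((inv_mul_lt_iff₀ hr).1 hlt))
  obtain ⟨S, hS, hgen, hres⟩ := h Δ hΔr
  obtain ⟨Q', hQ'⟩ := hS.inResolventSet_I_mul_int hres k
  rw [hgen] at hQ'
  have hl := hQ'.left_inv ⟨x, hQ.mem_domain (B v)⟩
  have e : addBounded A (B ∘L Δ ∘L C) ⟨x, hQ.mem_domain (B v)⟩ - (Complex.I * k) • x = 0 := by
    have e1 : addBounded A (B ∘L Δ ∘L C) ⟨x, hQ.mem_domain (B v)⟩ =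
      B (Δ (C x)) + A ⟨x, hQ.mem_domain (B v)⟩ := rfl
    rw [e1, ← hyx, hΔy, map_neg, add_sub_assoc, hQ.right_inv, neg_add_cancel]
  have hx0 : x = 0 := by
    rw [← map_zero Q', ← e]; exact hl.symm
  rw [hyx, hx0, map_zero, norm_zero] at hy0
  exact lt_irrefl _ hy0

theorem pointwiseStabRadius_le (hT : IsC0Semigroup T)
    (h1 : (1 : ℂ) ∈ resolventSet ℂ (T (2 * Real.pi))) (B : U →L[ℂ] X) (C : X →L[ℂ] Y) :
    pointwiseStabRadius 1 (2 * Real.pi) (generator T) B C ≤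
      1 / ⨆ k : ℤ, ‖transferFn (generator T) B C (Complex.I * (k : ℂ))‖ₑ := by
  refine sSup_le ?_
  rintro _ ⟨r, hr, rfl, h⟩
  rw [one_div, ENNReal.le_inv_iff_le_inv, ← ENNReal.ofReal_inv_of_pos hr]
  refine iSup_le fun k => ?_
  rw [← ofReal_norm]
  exact ENNReal.ofReal_le_ofReal
    (norm_transferFn_le B C hr (hT.inResolventSet_I_mul_int h1 k) h)

end Bounds

/-! ### Fourier modes and density of trigonometric polynomials -/

section FourierModes

local notation "𝕋" => AddCircle (2 * Real.pi)

/-- The Fourier mode `s ↦ e^{iks} v` as an element of `L^p`, depending linearly on `v`. -/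
def modeLp (E : Type*) [NormedAddCommGroup E] [NormedSpace ℂ E] (p : ℝ≥0∞) [Fact (1 ≤ p)] (k : ℤ) :
    E →L[ℂ] PerLp E p :=
  ContinuousMap.toLp p volume ℂ ∘L LinearMap.mkContinuous
    { toFun := fun v => (⟨fun s : 𝕋 => fourier k s • v, by fun_prop⟩ : C(𝕋, E))
      map_add' := fun v w => by ext s; simp
      map_smul' := fun c v => by ext s; simp [smul_comm c] }
    1 fun v => by
      rw [one_mul, ContinuousMap.norm_le _ (norm_nonneg v)]
      intro s
      change ‖fourier k s • v‖ ≤ ‖v‖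
      rw [norm_smul, fourier_apply, Circle.norm_coe, one_mul]

theorem modeLp_ae {E : Type*} [NormedAddCommGroup E] [NormedSpace ℂ E] {p : ℝ≥0∞} [Fact (1 ≤ p)]
    (k : ℤ) (v : E) : ∀ᵐ s : 𝕋, modeLp E p k v s = fourier k s • v :=
  ContinuousMap.coeFn_toLp (p := p) (𝕜 := ℂ) volume _

theorem fourier_sub_coe (k : ℤ) (s : 𝕋) (t : ℝ) :
    fourier k (s - (t : 𝕋)) = Complex.exp (-(Complex.I * k) * t) * fourier k s := by
  have h1 : fourier k (s - (t : 𝕋)) = fourier k s * fourier k (((-t : ℝ)) : 𝕋) := by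
    simp only [fourier_apply, sub_eq_add_neg, smul_add, AddCircle.toCircle_add, Circle.coe_mul,
      AddCircle.coe_neg]
  have h2 : (Real.pi : ℂ) ≠ 0 := by exact_mod_cast Real.pi_ne_zero
  rw [h1, fourier_coe_apply, mul_comm]
  congr 2
  push_cast
  field_simp

variable {X : Type*} [NormedAddCommGroup X] [NormedSpace ℂ X] {p : ℝ≥0∞} [Fact (1 ≤ p)]

theorem compLpL_modeLp {E F : Type*} [NormedAddCommGroup E] [NormedSpace ℂ E]
    [NormedAddCommGroup F] [NormedSpace ℂ F] (L : E →L[ℂ] F) (k : ℤ) (v : E) :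
    L.compLpL p volume (modeLp E p k v) = modeLp F p k (L v) := by
  refine Lp.ext ?_
  filter_upwards [L.coeFn_compLpL (p := p) (modeLp E p k v), modeLp_ae (p := p) k v,
    modeLp_ae (p := p) k (L v)] with s e1 e2 e3
  rw [e1, e2, e3, map_smul]

theorem perEvolution_modeLp (T : ℝ → X →L[ℂ] X) (t : ℝ) (k : ℤ) (v : X) :
    perEvolution T p t (modeLp X p k v) =
      modeLp X p k (expRescale (-(Complex.I * k)) T t v) := by
  refine Lp.ext ?_
  filter_upwards [perEvolution_apply_ae T p t (modeLp X p k v),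
    ae_comp_sub (modeLp_ae (p := p) k v) (t : 𝕋),
    modeLp_ae (p := p) k (expRescale (-(Complex.I * k)) T t v)] with s e1 e2 e3
  rw [e1, e2, e3, map_smul, expRescale, smul_apply, smul_smul, fourier_sub_coe, mul_comm]

/-- On the `k`-th mode translation contributes the factor `e^{-ikt}`, so `Γ_per` acts there as `A -
ik`. -/
theorem hasGenValue_modeLp {T : ℝ → X →L[ℂ] X} {x y : X} (h : HasGenValue T x y) (k : ℤ) :
    HasGenValue (perEvolution T p) (modeLp X p k x)
      (modeLp X p k (y - (Complex.I * k) • x)) := by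
  have h1 := ((modeLp X p k).continuous.tendsto _).comp (h.rescale (-(Complex.I * k)))
  rw [neg_smul, ← sub_eq_add_neg] at h1
  refine h1.congr fun t => ?_
  simp only [Function.comp_apply, map_smul, map_sub, perEvolution_modeLp]

theorem resolventOp_perGenerator_modeLp {T : ℝ → X →L[ℂ] X}
    (hper : InResolventSet (perGenerator T p) 0) {k : ℤ}
    (hk : InResolventSet (generator T) (Complex.I * k)) (x : X) :
    resolventOp (perGenerator T p) 0 (modeLp X p k x) =
      modeLp X p k (resolventOp (generator T) (Complex.I * k) x) := by
  obtain ⟨G, hG⟩ := hper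
  obtain ⟨Q, hQ⟩ := hk
  rw [hG.resolventOp_eq, hQ.resolventOp_eq]
  have h1 := hasGenValue_modeLp (p := p) ((isResolventAt_generator_iff.1 hQ).1 x) k
  rw [add_sub_cancel_right] at h1
  have h2 := (isResolventAt_generator_iff.1 hG).2 _ _ h1
  rwa [zero_smul, sub_zero] at h2

variable {U : Type*} [NormedAddCommGroup U] [NormedSpace ℂ U]
  {Y : Type*} [NormedAddCommGroup Y] [NormedSpace ℂ Y]

theorem perInputOutput_modeLp {T : ℝ → X →L[ℂ] X}
    (hper : InResolventSet (perGenerator T p) 0) {k : ℤ}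
    (hk : InResolventSet (generator T) (Complex.I * k)) (B : U →L[ℂ] X) (C : X →L[ℂ] Y) (v : U) :
    perInputOutput T p B C (modeLp U p k v) =
      modeLp Y p k (transferFn (generator T) B C (Complex.I * k) v) := by
  simp only [perInputOutput, transferFn, ContinuousLinearMap.comp_apply, compLpL_modeLp,
    resolventOp_perGenerator_modeLp hper hk]

/-- Vector-valued trigonometric polynomials in `L^p`. -/
def trigPoly (E : Type*) [NormedAddCommGroup E] [NormedSpace ℂ E] (p : ℝ≥0∞) [Fact (1 ≤ p)] :
    (ℤ →₀ E) →ₗ[ℂ] PerLp E p :=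
  Finsupp.lsum ℂ fun k => (modeLp E p k : E →ₗ[ℂ] PerLp E p)

theorem trigPoly_apply (a : ℤ →₀ U) :
    trigPoly U p a = ∑ k ∈ a.support, modeLp U p k (a k) := rfl

theorem modeLp_mem_range_trigPoly (k : ℤ) (v : U) :
    modeLp U p k v ∈ LinearMap.range (trigPoly U p) :=
  ⟨Finsupp.single k v, by simp [trigPoly]⟩

/-- Scalar exponentials span a uniformly dense subspace of `C(𝕋, ℂ)`, which is dense in `L^p`.
Tensoring with a fixed `v` covers indicator functions, hence simple functions. -/
theorem toSpanSingleton_compLpL_mem (hp : p ≠ ∞) (v : U) (φ : PerLp ℂ p) :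
    (ContinuousLinearMap.toSpanSingleton ℂ v).compLpL p volume φ ∈
      (LinearMap.range (trigPoly U p)).topologicalClosure := by
  set L : C(𝕋, ℂ) →L[ℂ] PerLp U p :=
    (ContinuousLinearMap.toSpanSingleton ℂ v).compLpL p volume ∘L
      ContinuousMap.toLp p volume ℂ with hL
  set V := (LinearMap.range (trigPoly U p)).topologicalClosure with hV
  have hVc : IsClosed (V : Set (PerLp U p)) := Submodule.isClosed_topologicalClosure _
  have h1 : ∀ g : C(𝕋, ℂ), L g ∈ V := by
    have h2 : (Submodule.span ℂ (Set.range (@fourier (2 * Real.pi)))).topologicalClosure ≤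
        V.comap (L : C(𝕋, ℂ) →ₗ[ℂ] PerLp U p) := by
      refine Submodule.topologicalClosure_minimal _ (Submodule.span_le.2 ?_)
        (hVc.preimage L.continuous)
      rintro _ ⟨k, rfl⟩
      have h3 : L (fourier k) = modeLp U p k v := by
        refine Lp.ext ?_
        filter_upwards [(ContinuousLinearMap.toSpanSingleton ℂ v).coeFn_compLpL (p := p)
            (ContinuousMap.toLp p volume ℂ (fourier k : C(𝕋, ℂ))),
          ContinuousMap.coeFn_toLp (p := p) (𝕜 := ℂ) volume (fourier k : C(𝕋, ℂ)),
          modeLp_ae (p := p) k v] with s e1 e2 e3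
        rw [hL, ContinuousLinearMap.comp_apply, e1, e2, e3]
        rfl
      change L (fourier k) ∈ V
      rw [h3]
      exact Submodule.le_topologicalClosure _ (modeLp_mem_range_trigPoly k v)
    rw [span_fourier_closure_eq_top] at h2
    exact fun g => h2 Submodule.mem_top
  refine (ContinuousMap.toLp_denseRange ℂ (volume : Measure 𝕋) ℂ hp).induction_on
    (p := fun φ => (ContinuousLinearMap.toSpanSingleton ℂ v).compLpL p volume φ ∈ V) φ ?_ h1
  exact hVc.preimage ((ContinuousLinearMap.toSpanSingleton ℂ v).compLpL p volume).continuous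

theorem denseRange_trigPoly (hp : p ≠ ∞) : DenseRange (trigPoly U p) := by
  have h : ∀ f : PerLp U p, f ∈ (LinearMap.range (trigPoly U p)).topologicalClosure := by
    refine Lp.induction hp _ (fun c s hs hμ => ?_) (fun f g _ _ _ h1 h2 => add_mem h1 h2)
      (Submodule.isClosed_topologicalClosure _)
    have e : ((Lp.simpleFunc.indicatorConst p hs hμ.ne c : Lp.simpleFunc U p volume) : PerLp U p) =
        (ContinuousLinearMap.toSpanSingleton ℂ c).compLpL p volume
          (indicatorConstLp p hs hμ.ne (1 : ℂ)) := by
      rw [Lp.simpleFunc.coe_indicatorConst]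
      refine Lp.ext ?_
      filter_upwards [indicatorConstLp_coeFn (p := p) (hs := hs) (hμs := hμ.ne) (c := c),
        indicatorConstLp_coeFn (p := p) (hs := hs) (hμs := hμ.ne) (c := (1 : ℂ)),
        (ContinuousLinearMap.toSpanSingleton ℂ c).coeFn_compLpL (p := p)
          (indicatorConstLp p hs hμ.ne (1 : ℂ))] with q e1 e2 e3
      rw [e1, e3, e2, ContinuousLinearMap.toSpanSingleton_apply]
      by_cases hm : q ∈ s <;> simp [Set.indicator, hm]
    rw [e]
    exact toSpanSingleton_compLpL_mem hp c _
  exact fun f => h f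

end FourierModes

/-! ### Parseval and the Hilbert space equality -/

section Hilbert

local notation "𝕋" => AddCircle (2 * Real.pi)

theorem integral_fourier_of_ne_zero {n : ℤ} (hn : n ≠ 0) : ∫ s : 𝕋, fourier n s = 0 :=
  integral_eq_zero_of_add_right_eq_neg (fourier_add_half_inv_index hn Real.two_pi_pos)

variable {E : Type*} [NormedAddCommGroup E] [InnerProductSpace ℂ E]

theorem inner_modeLp (k l : ℤ) (v w : E) :
    inner ℂ (modeLp E 2 k v) (modeLp E 2 l w) = (∫ s : 𝕋, fourier (l - k) s) * inner ℂ v w := by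
  rw [L2.inner_def, ← integral_mul_const]
  refine integral_congr_ae ?_
  filter_upwards [modeLp_ae (p := 2) k v, modeLp_ae (p := 2) l w] with s e1 e2
  rw [e1, e2, inner_smul_left, inner_smul_right, ← fourier_neg, sub_eq_add_neg, fourier_add]
  ring

/-- Parseval for finite sums. The measure is not normalized; its total mass appears identically for
input and output and drops out of the norm estimate. -/
theorem norm_trigPoly_sq (a : ℤ →₀ E) :
    ‖trigPoly E 2 a‖ ^ 2 = volume.real (Set.univ : Set 𝕋) * ∑ k ∈ a.support, ‖a k‖ ^ 2 := by
  have h : (‖trigPoly E 2 a‖ ^ 2 : ℂ) =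
      volume.real (Set.univ : Set 𝕋) * ∑ k ∈ a.support, (‖a k‖ ^ 2 : ℂ) := by
    refine (inner_self_eq_norm_sq_to_K (𝕜 := ℂ) (trigPoly E 2 a)).symm.trans ?_
    rw [trigPoly_apply, sum_inner, Finset.mul_sum]
    refine Finset.sum_congr rfl fun k hk => ?_
    rw [inner_sum, Finset.sum_eq_single_of_mem k hk]
    · rw [inner_modeLp, sub_self, inner_self_eq_norm_sq_to_K]
      simp
    · intro l _ hl
      rw [inner_modeLp, integral_fourier_of_ne_zero (sub_ne_zero.2 hl), zero_mul]
  exact_mod_cast h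

variable {X : Type*} [NormedAddCommGroup X] [NormedSpace ℂ X]
  {U : Type*} [NormedAddCommGroup U] [InnerProductSpace ℂ U]
  {Y : Type*} [NormedAddCommGroup Y] [InnerProductSpace ℂ Y]

/-- Plancherel bound for the input-output operator. -/
theorem norm_perInputOutput_two_le {T : ℝ → X →L[ℂ] X}
    (hper : InResolventSet (perGenerator T 2) 0)
    (hk : ∀ k : ℤ, InResolventSet (generator T) (Complex.I * (k : ℂ)))
    (B : U →L[ℂ] X) (C : X →L[ℂ] Y) {N : ℝ} (hN0 : 0 ≤ N)
    (hN : ∀ k : ℤ, ‖transferFn (generator T) B C (Complex.I * (k : ℂ))‖ ≤ N) :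
    ‖perInputOutput T 2 B C‖ ≤ N := by
  refine ContinuousLinearMap.opNorm_le_bound _ hN0 fun f => ?_
  refine (denseRange_trigPoly (U := U) (p := 2) ENNReal.ofNat_ne_top).induction_on
    (p := fun f => ‖perInputOutput T 2 B C f‖ ≤ N * ‖f‖) f
    (isClosed_le (by fun_prop) (by fun_prop)) fun a => ?_
  set F := fun k : ℤ => transferFn (generator T) B C (Complex.I * (k : ℂ)) with hF
  -- The output coefficients. Some may vanish, so the support can shrink and the sums are compared
  -- over a subset.
  let b : ℤ →₀ Y := Finsupp.onFinset a.support (fun k => F k (a k)) fun k hk => by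
    rw [Finsupp.mem_support_iff]
    rintro h0
    exact hk (by rw [h0, map_zero])
  have hbs : b.support ⊆ a.support := Finsupp.support_onFinset_subset
  have e : perInputOutput T 2 B C (trigPoly U 2 a) = trigPoly Y 2 b := by
    rw [trigPoly_apply, trigPoly_apply, map_sum]
    refine Eq.trans ?_ (Finset.sum_subset hbs fun k _ hk' => ?_).symm
    · exact Finset.sum_congr rfl fun k _ => perInputOutput_modeLp hper (hk k) B C (a k)
    · rw [Finsupp.notMem_support_iff.1 hk', map_zero]
  have hsq : ‖perInputOutput T 2 B C (trigPoly U 2 a)‖ ^ 2 ≤ (N * ‖trigPoly U 2 a‖) ^ 2 := by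
    rw [e, mul_pow, norm_trigPoly_sq, norm_trigPoly_sq, mul_left_comm,
      Finset.mul_sum a.support _ (N ^ 2)]
    refine mul_le_mul_of_nonneg_left ?_ measureReal_nonneg
    refine (Finset.sum_le_sum_of_subset_of_nonneg hbs fun _ _ _ => sq_nonneg _).trans ?_
    refine Finset.sum_le_sum fun k _ => ?_
    rw [← mul_pow]
    exact pow_le_pow_left₀ (norm_nonneg _) ((F k).le_of_opNorm_le (hN k) (a k)) 2
  exact le_of_sq_le_sq hsq (by positivity)

theorem enorm_perInputOutput_two_le {T : ℝ → X →L[ℂ] X}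
    (hper : InResolventSet (perGenerator T 2) 0)
    (hk : ∀ k : ℤ, InResolventSet (generator T) (Complex.I * (k : ℂ)))
    (B : U →L[ℂ] X) (C : X →L[ℂ] Y) :
    ‖perInputOutput T 2 B C‖ₑ ≤
      ⨆ k : ℤ, ‖transferFn (generator T) B C (Complex.I * (k : ℂ))‖ₑ := by
  set N := ⨆ k : ℤ, ‖transferFn (generator T) B C (Complex.I * (k : ℂ))‖ₑ with hN
  rcases eq_or_ne N ∞ with h | h
  · rw [h]; exact le_top
  · rw [← ofReal_norm, ← ENNReal.ofReal_toReal h]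
    refine ENNReal.ofReal_le_ofReal
      (norm_perInputOutput_two_le hper hk B C ENNReal.toReal_nonneg fun k => ?_)
    rw [← toReal_enorm]
    exact ENNReal.toReal_mono h (le_iSup (fun k : ℤ =>
      ‖transferFn (generator T) B C (Complex.I * (k : ℂ))‖ₑ) k)

end Hilbert

end StabRadius

end

theorem theorem3p4 {X : Type u} [NormedAddCommGroup X] [NormedSpace ℂ X]
    [CompleteSpace X] (T : ℝ → X →L[ℂ] X) (hT : StabRadius.IsC0Semigroup T)
    (h1 : (1 : ℂ) ∈ resolventSet ℂ (T (2 * Real.pi))) :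
    -- all the inverses that occur below exist as bounded operators
    (∀ k : ℤ, StabRadius.InResolventSet (StabRadius.generator T) (Complex.I * (k : ℂ))) ∧
    (∀ (p : ℝ≥0∞) [Fact (1 ≤ p)], p ≠ ∞ →
      StabRadius.InResolventSet (StabRadius.perGenerator T p) 0) ∧
    -- the two-sided estimate for Banach spaces
    (∀ (U : Type v) (Y : Type w) [NormedAddCommGroup U] [NormedSpace ℂ U] [CompleteSpace U]
        [NormedAddCommGroup Y] [NormedSpace ℂ Y] [CompleteSpace Y]
        (p : ℝ≥0∞) [Fact (1 ≤ p)] (B : U →L[ℂ] X) (C : X →L[ℂ] Y), p ≠ ∞ →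
      1 / ‖StabRadius.perInputOutput T p B C‖ₑ ≤
          StabRadius.pointwiseStabRadius 1 (2 * Real.pi) (StabRadius.generator T) B C ∧
      StabRadius.pointwiseStabRadius 1 (2 * Real.pi) (StabRadius.generator T) B C ≤
          1 / ⨆ k : ℤ, ‖StabRadius.transferFn (StabRadius.generator T) B C
            (Complex.I * (k : ℂ))‖ₑ) ∧
    -- equalities for Hilbert spaces `U`, `Y` and `p = 2`
    (∀ (U : Type v) (Y : Type w) [NormedAddCommGroup U] [InnerProductSpace ℂ U] [CompleteSpace U]
        [NormedAddCommGroup Y] [InnerProductSpace ℂ Y] [CompleteSpace Y]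
        (B : U →L[ℂ] X) (C : X →L[ℂ] Y),
      1 / ‖StabRadius.perInputOutput T 2 B C‖ₑ =
          StabRadius.pointwiseStabRadius 1 (2 * Real.pi) (StabRadius.generator T) B C ∧
      StabRadius.pointwiseStabRadius 1 (2 * Real.pi) (StabRadius.generator T) B C =
          1 / ⨆ k : ℤ, ‖StabRadius.transferFn (StabRadius.generator T) B C
            (Complex.I * (k : ℂ))‖ₑ) := by
  have hres := fun k : ℤ => hT.inResolventSet_I_mul_int h1 k
  have hper : ∀ (p : ℝ≥0∞) [Fact (1 ≤ p)], p ≠ ∞ →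
      StabRadius.InResolventSet (StabRadius.perGenerator T p) 0 := by
    intro p _ hp
    obtain ⟨R, hR1, hR2⟩ := StabRadius.exists_inverse_of_mem_resolventSet h1
    exact ⟨_, StabRadius.isResolventAt_perGenerator hT hp hR1 hR2⟩
  refine ⟨hres, hper, ?_, ?_⟩
  · intro U Y _ _ _ _ _ _ p _ B C hp
    exact ⟨StabRadius.inv_norm_perInputOutput_le_pointwiseStabRadius hT h1 hp B C,
      StabRadius.pointwiseStabRadius_le hT h1 B C⟩
  · intro U Y _ _ _ _ _ _ B C
    have h2 : (2 : ℝ≥0∞) ≠ ∞ := ENNReal.ofNat_ne_top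
    have hlo := StabRadius.inv_norm_perInputOutput_le_pointwiseStabRadius hT h1 h2 B C
    have hup := StabRadius.pointwiseStabRadius_le hT h1 B C
    -- Inverting the Parseval bound places the upper estimate below the lower one, so all three
    -- quantities agree.
    have hle := ENNReal.div_le_div_left
      (StabRadius.enorm_perInputOutput_two_le (hper 2 h2) hres B C) 1
    exact ⟨le_antisymm hlo (hup.trans hle), le_antisymm hup (hle.trans hlo)⟩
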